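/- Let $\alpha,\beta>0$ be real with $\beta/\alpha\notin\mathbb{Z}$, and let $\mathbb{T}=\mathbb{R}/2\pi\mathbb{Z}$. Write $\langle x\rangle=(1+|x|^2)^{1/2}$ and $\tilde u(k,\tau)=\iint_{\mathbb{R}\times\mathbb{T}}e^{-ikx-i\tau t}u(t,x)\,dx\,dt$ for $k\in\mathbb{Z}$, $\tau\in\mathbb{R}$. For $s\in\mathbb{R}$, and with $m_S(k,\tau)=\tau-\alpha k^2$, $m_W(k,\tau)=|\tau|-\beta|k|$, put for $A\in\{S,W\}$ $$\|u\|_{Y^s_A}=\big\|\langle k\rangle^s\langle m_A\rangle^{1/2}\tilde u\big\|_{\ell^2_kL^2_\tau}+\big\|\langle k\rangle^s\tilde u\big\|_{\ell^2_kL^1_\tau},\qquad \|u\|_{Z^s_A}=\big\|\langle k\rangle^s\langle m_A\rangle^{-1/2}\tilde u\big\|_{\ell^2_kL^2_\tau}+\big\|\langle k\rangle^s\langle m_A\rangle^{-1}\tilde u\big\|_{\ell^2_kL^1_\tau},$$ and let $Y^s_A$, $Z^s_A$ be the corresponding spaces of space-time distributions $u$ on $\mathbb{R}\times\mathbb{T}$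 whose Fourier transform $\tilde u$ is a function and whose norm is finite. For $T>0$ let $\|g\|_{Z^s_A([0,T]\times\mathbb{T})}$ be the infimum of $\|F\|_{Z^s_A}$ over all $F\in Z^s_A$ that coincide with $g$ on $(0,T)\times\mathbb{T}$. For $N=2^j$, $j=0,1,2,\dots$, let $P_N$ be the projection onto the spatial frequencies $k\in\mathbb{Z}$ with $N\le|k|<2N$. Then there is $\gamma_0>0$ such that for every $0<\gamma<\gamma_0$ there is a constant $C>0$ (depending only on $\alpha,\beta,\gamma$) such that, for all $0<T<1$ and all dyadic numbers $N_0,N_1,N_2\in\{1,2,4,\dots\}$, $$\big\|P_{N_0}\big(P_{N_1}u\,P_{N_2}v\big)\big\|_{Z^0_S([0,T]\times\mathbb{T})}\le C\,T^\gamma\,\|u\|_{Y^0_S}\,\|v\|_{Y^{-1/2}_W}\qquad\text{for all }u\in Y^0_S,\ v\in Y^{-1/2}_W,$$ $$\big\|P_{N_0}\,\partial_x\big(P_{N_1}u\,\overline{P_{N_2}v}\big)\big\|_{Z^{-1/2}_W([0,T]\times\mathbb{T})}\le C\,T^\gamma\,\|u\|_{Y^0_S}\,\|v\|_{Y^0_S}\qquad\text{for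 all }u,v\in Y^0_S.$$ -/

import Mathlib

open MeasureTheory
open scoped SchwartzMap ENNReal

namespace Zakharov

noncomputable section

/-- A space-time distribution on `ℝ × 𝕋`, `𝕋 = ℝ / 2πℤ`, given by its sequence of spatial Fourier
coefficients: `u k ∈ 𝓢'(ℝ)` is the time distribution `û_k`, where for a function
`û_k(t) = ∫_𝕋 e^{-ikx} u(t, x) dx`.  Finiteness of any of the norms below forces polynomial growth
of the coefficients in `k`, so that the spaces of elements of finite norm are spaces of tempered
distributions on `ℝ × 𝕋`. -/
abbrev STDist : Type := ℤ → 𝓢'(ℝ, ℂ)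

/-- `f` is the space-time Fourier transform `ũ(k, τ) = ∫∫ e^{-ikx} e^{-iτt} u(t, x) dx dt`
(and this transform is a function): by Fourier inversion in time,
`û_k(t) = (1 / 2π) ∫ e^{iτt} f(k, τ) dτ` in the sense of tempered distributions.
Such an `f` is unique up to null sets in `τ`. -/
def IsSTFourier (u : STDist) (f : ℤ → ℝ → ℂ) : Prop :=
  ∀ (k : ℤ) (φ : 𝓢(ℝ, ℂ)),
    Integrable (fun τ : ℝ => f k τ * ∫ t : ℝ, Complex.exp (Complex.I * τ * t) * φ t) ∧
    u k φ = (1 / (2 * Real.pi) : ℂ) *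
      ∫ τ : ℝ, f k τ * ∫ t : ℝ, Complex.exp (Complex.I * τ * t) * φ t

/-- The space-time Fourier transform of `u` is a function. -/
def HasSTFourier (u : STDist) : Prop := ∃ f, IsSTFourier u f

open Classical in
/-- The space-time Fourier transform `ũ(k, τ)`, when it is a function. -/
def stFourier (u : STDist) : ℤ → ℝ → ℂ :=
  if h : HasSTFourier u then h.choose else 0

/-- The bracket `⟨x⟩ = (1 + |x|²)^{1/2}`. -/
def bracket (x : ℝ) : ℝ := Real.sqrt (1 + |x| ^ 2)

/-- The norm `‖w(k, τ) f(k, τ)‖` in `ℓ²_k L²_τ`. -/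
def l2L2 (w : ℤ → ℝ → ℝ) (f : ℤ → ℝ → ℂ) : ℝ≥0∞ :=
  (∑' k : ℤ, ∫⁻ τ : ℝ, (ENNReal.ofReal (w k τ) * ‖f k τ‖ₑ) ^ 2) ^ (1 / 2 : ℝ)

/-- The norm `‖w(k, τ) f(k, τ)‖` in `ℓ²_k L¹_τ`. -/
def l2L1 (w : ℤ → ℝ → ℝ) (f : ℤ → ℝ → ℂ) : ℝ≥0∞ :=
  (∑' k : ℤ, (∫⁻ τ : ℝ, ENNReal.ofReal (w k τ) * ‖f k τ‖ₑ) ^ 2) ^ (1 / 2 : ℝ)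

/-- The Schrödinger modulation `τ - α k²`. -/
def modS (α : ℝ) (k : ℤ) (τ : ℝ) : ℝ := τ - α * (k : ℝ) ^ 2

/-- The wave modulation `|τ| - β |k|`. -/
def modW (β : ℝ) (k : ℤ) (τ : ℝ) : ℝ := |τ| - β * |(k : ℝ)|

open Classical in
/-- The Bourgain norm with modulation function `m`:
`‖⟨k⟩^s ⟨m(k, τ)⟩^b ũ(k, τ)‖` in `ℓ²_k L²_τ` (`∞` if `ũ` is not a function). -/
def normX (m : ℤ → ℝ → ℝ) (s b : ℝ) (u : STDist) : ℝ≥0∞ :=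
  if HasSTFourier u then
    l2L2 (fun k τ => bracket k ^ s * bracket (m k τ) ^ b) (stFourier u)
  else ⊤

open Classical in
/-- `‖u‖_{X^{s,1/2}} + ‖⟨k⟩^s ũ‖_{ℓ²_k L¹_τ}`. -/
def normY (m : ℤ → ℝ → ℝ) (s : ℝ) (u : STDist) : ℝ≥0∞ :=
  normX m s (1 / 2) u +
    if HasSTFourier u then l2L1 (fun k _ => bracket k ^ s) (stFourier u) else ⊤

open Classical in
/-- `‖u‖_{X^{s,-1/2}} + ‖⟨k⟩^s ⟨m(k, τ)⟩^{-1} ũ‖_{ℓ²_k L¹_τ}`. -/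
def normZ (m : ℤ → ℝ → ℝ) (s : ℝ) (u : STDist) : ℝ≥0∞ :=
  normX m s (-1 / 2) u +
    if HasSTFourier u then l2L1 (fun k τ => bracket k ^ s / bracket (m k τ)) (stFourier u) else ⊤

/-- The norm of `Y^s_S`. -/
def normYS (α s : ℝ) (u : STDist) : ℝ≥0∞ := normY (modS α) s u

/-- The norm of `Z^s_S`. -/
def normZS (α s : ℝ) (u : STDist) : ℝ≥0∞ := normZ (modS α) s u

/-- The norm of `Y^s_W`. -/
def normYW (β s : ℝ) (u : STDist) : ℝ≥0∞ := normY (modW β) s u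

/-- The norm of `Z^s_W`. -/
def normZW (β s : ℝ) (u : STDist) : ℝ≥0∞ := normZ (modW β) s u

/-- The `k`-th spatial Fourier coefficient at time `t` of a function `g(t, x)`, `2π`-periodic
in `x`: `∫_𝕋 e^{-ikx} g(t, x) dx`. -/
def spaceCoeff (g : ℝ → ℝ → ℂ) (k : ℤ) (t : ℝ) : ℂ :=
  ∫ x in (0 : ℝ)..(2 * Real.pi), Complex.exp (-(Complex.I * k * x)) * g t x

/-- `F` coincides with the function `g` on `[0, T] × 𝕋`, as a distribution on its interior. -/
def AgreesOn (T : ℝ) (F : STDist) (g : ℝ → ℝ → ℂ) : Prop :=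
  ∀ (k : ℤ) (φ : 𝓢(ℝ, ℂ)), tsupport φ ⊆ Set.Ioo 0 T →
    F k φ = ∫ t : ℝ, spaceCoeff g k t * φ t

/-- The restriction norm of `Z^s_S([0, T] × 𝕋)`: the infimum of the norms of the extensions. -/
def normZSOn (α s T : ℝ) (g : ℝ → ℝ → ℂ) : ℝ≥0∞ :=
  ⨅ (F : STDist) (_ : AgreesOn T F g), normZS α s F

/-- The restriction norm of `Z^s_W([0, T] × 𝕋)`: the infimum of the norms of the extensions. -/
def normZWOn (β s T : ℝ) (g : ℝ → ℝ → ℂ) : ℝ≥0∞ :=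
  ⨅ (F : STDist) (_ : AgreesOn T F g), normZW β s F

/-- The frequencies `k ∈ ℤ` with `N ≤ |k| < 2N`. -/
def shell (N : ℕ) : Finset ℤ :=
  (Finset.Ioo (-(2 * N : ℤ)) (2 * N)).filter fun k => (N : ℤ) ≤ |k|

/-- The Littlewood-Paley projection of a function of `(t, x)`, `2π`-periodic in `x`. -/
def projFun (N : ℕ) (g : ℝ → ℝ → ℂ) (t x : ℝ) : ℂ :=
  (1 / (2 * Real.pi) : ℂ) * ∑ k ∈ shell N, Complex.exp (Complex.I * k * x) * spaceCoeff g k t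

/-- The Littlewood-Paley projection `P_N u` of a distribution `u` for which every `ũ(k, ·)` is
integrable (this holds if a `Y` norm is finite), as a function of `(t, x)`: here
`û_k(t) = (1 / 2π) ∫ e^{iτt} ũ(k, τ) dτ`. -/
def proj (N : ℕ) (u : STDist) (t x : ℝ) : ℂ :=
  (1 / (2 * Real.pi) : ℂ) * ∑ k ∈ shell N, Complex.exp (Complex.I * k * x) *
    ((1 / (2 * Real.pi) : ℂ) * ∫ τ : ℝ, Complex.exp (Complex.I * τ * t) * stFourier u k τ)

/-- The spatial derivative of a function of `(t, x)`. -/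
def dx (g : ℝ → ℝ → ℂ) (t x : ℝ) : ℂ := deriv (fun y : ℝ => g t y) x

end

end Zakharov

/-!
After a smooth cutoff of both factors to `[0, T]`, the products become convolutions over the
space-time frequencies. For Schrödinger frequencies `k = j + q`, `j` and a wave frequency `q`,
the three modulations add up to at least `|α q| |2j + q ± β / α|`. As `β / α` is not an
integer, this is comparable to `⟨q⟩ ⟨2j + q⟩` for `q ≠ 0`, so a half power of the largest
modulation pays for the loss of `⟨q⟩^{1/2}` and leaves a gain `⟨2j + q⟩^{-1/2}`. The rest is
Cauchy–Schwarz, with kernels bounded by sums over `q ∈ ℤ` of negative powers of brackets of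
linear and quadratic polynomials; it uses the power `3 / 8` instead of `1 / 2` of the
modulation of at least one of the two factors, and on functions cut off to `[0, T]` this
difference gains the factor `T^{1/8}`.
-/

namespace Zakharov

lemma one_le_bracket (x : ℝ) : 1 ≤ bracket x :=
  Real.one_le_sqrt.mpr (by nlinarith [sq_nonneg |x|])

lemma bracket_pos (x : ℝ) : 0 < bracket x := one_pos.trans_le (one_le_bracket x)

lemma sq_bracket (x : ℝ) : bracket x ^ 2 = 1 + x ^ 2 := by
  rw [bracket, Real.sq_sqrt (by positivity), sq_abs]

lemma abs_le_bracket (x : ℝ) : |x| ≤ bracket x :=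
  Real.abs_le_sqrt (by rw [sq_abs]; linarith)

lemma bracket_le_one_add_abs (x : ℝ) : bracket x ≤ 1 + |x| :=
  Real.sqrt_le_iff.mpr ⟨by positivity, by nlinarith [abs_nonneg x]⟩

lemma bracket_neg (x : ℝ) : bracket (-x) = bracket x := by rw [bracket, bracket, abs_neg]

lemma bracket_add_le (x y : ℝ) : bracket (x + y) ≤ bracket x + |y| := by
  have hxy : x * y ≤ bracket x * |y| :=
    (le_abs_self _).trans (by rw [abs_mul]; gcongr; exact abs_le_bracket x)
  refine abs_le_of_sq_le_sq' ?_ (by positivity [bracket_pos x]) |>.2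
  nlinarith [sq_bracket x, sq_bracket (x + y), sq_abs y]

lemma continuous_bracket : Continuous bracket := by
  unfold bracket
  fun_prop

lemma min_mul_bracket_le {d x y : ℝ} (hd : 0 < d) (h : d * |y| ≤ |x|) :
    min d 1 * bracket y ≤ bracket x := by
  have hmin : 0 < min d 1 := by positivity
  have h_abs : (min d 1 * |y|) ^ 2 ≤ |x| ^ 2 := by
    gcongr
    exact (mul_le_mul_of_nonneg_right (min_le_left d 1) (abs_nonneg y)).trans h
  rw [mul_pow, sq_abs, sq_abs] at h_abs
  refine abs_le_of_sq_le_sq' ?_ (bracket_pos x).le |>.2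
  rw [mul_pow, sq_bracket, sq_bracket]
  nlinarith [pow_le_one₀ hmin.le (min_le_right d 1) (n := 2)]

/-- The bracket `⟨x⟩` as an extended nonnegative real, for use in Lebesgue integrals and in sums
that need not converge. -/
noncomputable def ebracket (x : ℝ) : ℝ≥0∞ := ENNReal.ofReal (bracket x)

local notation "⟪" x "⟫" => ebracket x

lemma one_le_ebracket (x : ℝ) : 1 ≤ ⟪x⟫ := ENNReal.one_le_ofReal.mpr (one_le_bracket x)

lemma ebracket_ne_top (x : ℝ) : ⟪x⟫ ≠ ⊤ := ENNReal.ofReal_ne_top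

lemma ebracket_ne_zero (x : ℝ) : ⟪x⟫ ≠ 0 := (one_pos.trans_le (one_le_ebracket x)).ne'

lemma ebracket_rpow_ne_top (x a : ℝ) : ⟪x⟫ ^ a ≠ ⊤ :=
  ENNReal.rpow_ne_top_of_ne_zero (ebracket_ne_zero x) (ebracket_ne_top x)

lemma ebracket_rpow_ne_zero (x a : ℝ) : ⟪x⟫ ^ a ≠ 0 := by
  simp [ENNReal.rpow_eq_zero_iff, ebracket_ne_zero, ebracket_ne_top]

lemma ebracket_rpow (x a : ℝ) : ⟪x⟫ ^ a = ENNReal.ofReal (bracket x ^ a) :=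
  ENNReal.ofReal_rpow_of_pos (bracket_pos x)

lemma ebracket_rpow_add (x a b : ℝ) : ⟪x⟫ ^ (a + b) = ⟪x⟫ ^ a * ⟪x⟫ ^ b :=
  ENNReal.rpow_add _ _ (ebracket_ne_zero x) (ebracket_ne_top x)

lemma ebracket_neg (x : ℝ) : ⟪-x⟫ = ⟪x⟫ := by rw [ebracket, bracket_neg, ebracket]

lemma ebracket_sub_comm (x y : ℝ) : ⟪x - y⟫ = ⟪y - x⟫ := by rw [← ebracket_neg, neg_sub]

lemma ebracket_congr_abs {x y : ℝ} (h : |x| = |y|) : ⟪x⟫ = ⟪y⟫ := by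
  rw [ebracket, bracket, h, ebracket, bracket]

lemma ebracket_add_le (x y : ℝ) : ⟪x + y⟫ ≤ ⟪x⟫ + ⟪y⟫ := by
  rw [ebracket, ebracket, ebracket, ← ENNReal.ofReal_add (bracket_pos x).le (bracket_pos y).le]
  exact ENNReal.ofReal_le_ofReal
    ((bracket_add_le x y).trans (add_le_add_right (abs_le_bracket y) _))

@[fun_prop]
lemma measurable_ebracket : Measurable ebracket := continuous_bracket.measurable.ennreal_ofReal

lemma rpow_le_rpow_of_nonpos {x y : ℝ≥0∞} (h : x ≤ y) {a : ℝ} (ha : a ≤ 0) : y ^ a ≤ x ^ a := by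
  rw [← ENNReal.inv_le_inv, ← ENNReal.rpow_neg, ← ENNReal.rpow_neg]
  exact ENNReal.rpow_le_rpow h (neg_nonneg.mpr ha)

lemma rpow_le_one_of_nonpos {x : ℝ≥0∞} (h : 1 ≤ x) {a : ℝ} (ha : a ≤ 0) : x ^ a ≤ 1 := by
  simpa only [ENNReal.one_rpow] using rpow_le_rpow_of_nonpos h ha

lemma ebracket_rpow_mul_rpow_le (x y : ℝ) {a b : ℝ} (ha : a ≤ 0) (hb : b ≤ 0) :
    ⟪x⟫ ^ a * ⟪y⟫ ^ b ≤ ⟪x⟫ ^ (a + b) + ⟪y⟫ ^ (a + b) := by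
  rw [ebracket_rpow_add, ebracket_rpow_add]
  rcases le_total ⟪x⟫ ⟪y⟫ with h | h
  · exact le_add_right (mul_le_mul_right (rpow_le_rpow_of_nonpos h hb) _)
  · exact le_add_left (mul_le_mul_left (rpow_le_rpow_of_nonpos h ha) _)

lemma rpow_le_mul_rpow_of_mul_le {D x y : ℝ≥0∞} (hD : D ≠ 0) (hx : x ≠ 0) (h : D * x ≤ y)
    {a : ℝ} (ha : a ≤ 0) : y ^ a ≤ D ^ a * x ^ a :=
  (rpow_le_rpow_of_nonpos h ha).trans_eq (ENNReal.mul_rpow_of_ne_zero hD hx a)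

lemma lintegral_ebracket_rpow_le {r : ℝ} (hr : 1 < r) :
    ∃ C : ℝ≥0∞, C ≠ ⊤ ∧ ∀ c : ℝ, ∫⁻ x : ℝ, ⟪x - c⟫ ^ (-r) ≤ C := by
  refine ⟨∫⁻ x : ℝ, ⟪x⟫ ^ (-r), ?_, fun c => (lintegral_sub_right_eq_self _ c).le⟩
  have h_int : Integrable (fun x : ℝ => (1 / 2 : ℝ) ^ (-r) * (1 + ‖x‖) ^ (-r)) :=
    (integrable_one_add_norm (by simpa using hr)).const_mul _
  refine ne_top_of_le_ne_top h_int.lintegral_lt_top.ne (lintegral_mono fun x => ?_)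
  rw [ebracket_rpow, ← Real.mul_rpow (by positivity) (by positivity), Real.norm_eq_abs]
  refine ENNReal.ofReal_le_ofReal (Real.rpow_le_rpow_of_nonpos (by positivity) ?_ (by linarith))
  linarith [one_le_bracket x, abs_le_bracket x]

lemma tsum_ebracket_rpow_le {r : ℝ} (hr : 1 < r) :
    ∃ C : ℝ≥0∞, C ≠ ⊤ ∧ ∀ c : ℝ, ∑' n : ℤ, ⟪n - c⟫ ^ (-r) ≤ C := by
  obtain ⟨C, hC, h_int⟩ := lintegral_ebracket_rpow_le hr
  refine ⟨2 ^ r * C, by finiteness, fun c => ?_⟩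
  have h_unit : ∀ (n : ℤ) (x : ℝ), x ∈ Set.Ioc (n : ℝ) (n + 1) →
      ⟪n - c⟫ ^ (-r) ≤ 2 ^ r * ⟪x - c⟫ ^ (-r) := by
    intro n x hx
    have h_half : 2⁻¹ * ⟪x - c⟫ ≤ ⟪n - c⟫ := by
      rw [ENNReal.inv_mul_le_iff (by norm_num) (by norm_num), ebracket, ebracket,
        ← ENNReal.ofReal_ofNat 2, ← ENNReal.ofReal_mul (by norm_num)]
      refine ENNReal.ofReal_le_ofReal ?_
      have h_add := bracket_add_le (n - c) (x - n)
      rw [abs_of_pos (by linarith [hx.1]), show n - c + (x - n) = x - c by ring] at h_add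
      linarith [one_le_bracket (n - c), hx.2]
    refine (rpow_le_mul_rpow_of_mul_le (by norm_num) (ebracket_ne_zero _) h_half
      (by linarith)).trans_eq ?_
    rw [ENNReal.inv_rpow, ← ENNReal.rpow_neg, neg_neg]
  calc ∑' n : ℤ, ⟪n - c⟫ ^ (-r)
      ≤ ∑' n : ℤ, ∫⁻ x in Set.Ioc (n : ℝ) (n + 1), 2 ^ r * ⟪x - c⟫ ^ (-r) := by
        refine ENNReal.tsum_le_tsum fun n => ?_
        simpa using setLIntegral_mono (μ := volume) (by fun_prop) (h_unit n)
    _ = ∫⁻ x : ℝ, 2 ^ r * ⟪x - c⟫ ^ (-r) := by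
        rw [← lintegral_iUnion (fun _ => measurableSet_Ioc) (Set.pairwise_disjoint_Ioc_intCast ℝ),
          iUnion_Ioc_intCast, setLIntegral_univ]
    _ ≤ 2 ^ r * C := by
        rw [lintegral_const_mul _ (by fun_prop)]
        gcongr
        exact h_int c

lemma tsum_ebracket_linear_rpow_le {r d : ℝ} (hr : 1 < r) (hd : 0 < d) :
    ∃ C : ℝ≥0∞, C ≠ ⊤ ∧ ∀ a c : ℝ, d ≤ |a| → ∑' n : ℤ, ⟪a * n + c⟫ ^ (-r) ≤ C := by
  obtain ⟨C, hC, h⟩ := tsum_ebracket_rpow_le hr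
  have hd' : 0 < min d 1 := by positivity
  have hD : ENNReal.ofReal (min d 1) ≠ 0 := by simpa using hd
  have hD_rpow : ENNReal.ofReal (min d 1) ^ (-r) ≠ ⊤ :=
    ENNReal.rpow_ne_top_of_ne_zero hD ENNReal.ofReal_ne_top
  refine ⟨ENNReal.ofReal (min d 1) ^ (-r) * C, by finiteness, fun a c had => ?_⟩
  have ha : a ≠ 0 := abs_pos.mp (hd.trans_le had)
  have h_scale : ∀ n : ℤ, ⟪a * n + c⟫ ^ (-r) ≤
      ENNReal.ofReal (min d 1) ^ (-r) * ⟪n - -c / a⟫ ^ (-r) := by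
    intro n
    refine rpow_le_mul_rpow_of_mul_le hD (ebracket_ne_zero _) ?_
      (by linarith)
    rw [ebracket, ebracket, ← ENNReal.ofReal_mul hd'.le]
    refine ENNReal.ofReal_le_ofReal (min_mul_bracket_le hd ?_)
    rw [show a * n + c = a * (n - -c / a) by field_simp; ring, abs_mul]
    gcongr
  calc ∑' n : ℤ, ⟪a * n + c⟫ ^ (-r)
      ≤ ENNReal.ofReal (min d 1) ^ (-r) * ∑' n : ℤ, ⟪n - -c / a⟫ ^ (-r) := by
        rw [← ENNReal.tsum_mul_left]
        exact ENNReal.tsum_le_tsum h_scale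
    _ ≤ _ := by gcongr; exact h _

lemma exists_abs_mul_sq_le_abs_quadratic {a : ℝ} (ha : a ≠ 0) (b c : ℝ) :
    ∃ x₁ x₂ : ℝ, ∀ x : ℝ, |a| * (x - x₁) ^ 2 ≤ |a * x ^ 2 + b * x + c| ∨
      |a| * (x - x₂) ^ 2 ≤ |a * x ^ 2 + b * x + c| := by
  -- `x₁` and `x₂` are the real parts of the two complex roots.
  obtain ⟨w, hw⟩ := IsAlgClosed.exists_eq_mul_self (((b ^ 2 - 4 * a * c) / (4 * a ^ 2) : ℝ) : ℂ)
  set y := -b / (2 * a) with hy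
  refine ⟨y + w.re, y - w.re, fun x => ?_⟩
  have h_factor : |a * x ^ 2 + b * x + c| = |a| * (‖(x - y - w : ℂ)‖ * ‖(x - y + w : ℂ)‖) := by
    have h_prod : (x - y - w : ℂ) * (x - y + w) =
        (((x - y) ^ 2 - (b ^ 2 - 4 * a * c) / (4 * a ^ 2) : ℝ) : ℂ) := by
      rw [Complex.ofReal_sub _ (_ / _), hw]
      push_cast
      ring
    rw [← norm_mul, h_prod, Complex.norm_real, Real.norm_eq_abs, ← abs_mul, hy]
    congr 1
    field_simp
    ring
  have h₁ : |x - (y + w.re)| ≤ ‖(x - y - w : ℂ)‖ :=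
    (Complex.abs_re_le_norm _).trans_eq' (by simp [sub_sub])
  have h₂ : |x - (y - w.re)| ≤ ‖(x - y + w : ℂ)‖ :=
    (Complex.abs_re_le_norm _).trans_eq' (by simp [sub_add])
  rw [h_factor, ← sq_abs (x - (y + w.re)), ← sq_abs (x - (y - w.re)), sq, sq]
  rcases le_total |x - (y + w.re)| |x - (y - w.re)| with h | h
  · left; gcongr; exact h.trans h₂
  · right; gcongr; exact h.trans h₁

lemma tsum_ebracket_quadratic_rpow_le {r d : ℝ} (hr : 1 / 2 < r) (hd : 0 < d) :
    ∃ C : ℝ≥0∞, C ≠ ⊤ ∧ ∀ a b c : ℝ, d ≤ |a| →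
      ∑' n : ℤ, ⟪a * n ^ 2 + b * n + c⟫ ^ (-r) ≤ C := by
  obtain ⟨C, hC, h⟩ := tsum_ebracket_rpow_le (r := 2 * r) (by linarith)
  set D := ENNReal.ofReal (min d 1 / 2) with hD_def
  have hD : D ≠ 0 := by simpa [D] using hd
  have hD_rpow : D ^ (-r) ≠ ⊤ := ENNReal.rpow_ne_top_of_ne_zero hD ENNReal.ofReal_ne_top
  refine ⟨D ^ (-r) * (C + C), by finiteness, fun a b c had => ?_⟩
  obtain ⟨x₁, x₂, hx⟩ :=
    exists_abs_mul_sq_le_abs_quadratic (abs_pos.mp (hd.trans_le had)) b c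
  have h_sq : ∀ s v : ℝ, |a| * s ^ 2 ≤ |v| → ⟪v⟫ ^ (-r) ≤ D ^ (-r) * ⟪s⟫ ^ (-(2 * r)) := by
    intro s v hv
    rw [show -(2 * r) = (2 : ℕ) * -r by push_cast; ring, ENNReal.rpow_mul, ENNReal.rpow_natCast]
    refine rpow_le_mul_rpow_of_mul_le hD
      (pow_ne_zero 2 (ebracket_ne_zero s)) ?_ (by linarith)
    rw [ebracket, ebracket, hD_def, ← ENNReal.ofReal_pow (bracket_pos s).le,
      ← ENNReal.ofReal_mul (by positivity), sq_bracket]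
    refine ENNReal.ofReal_le_ofReal ?_
    nlinarith [one_le_bracket v, abs_le_bracket v, min_le_left d 1, min_le_right d 1, sq_nonneg s]
  calc ∑' n : ℤ, ⟪a * n ^ 2 + b * n + c⟫ ^ (-r)
      ≤ ∑' n : ℤ, D ^ (-r) * (⟪n - x₁⟫ ^ (-(2 * r)) + ⟪n - x₂⟫ ^ (-(2 * r))) := by
        refine ENNReal.tsum_le_tsum fun n => ?_
        rw [mul_add]
        exact (hx n).elim (fun h₁ => le_add_right (h_sq _ _ h₁))
          fun h₂ => le_add_left (h_sq _ _ h₂)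
    _ = D ^ (-r) * (∑' n : ℤ, ⟪n - x₁⟫ ^ (-(2 * r)) + ∑' n : ℤ, ⟪n - x₂⟫ ^ (-(2 * r))) := by
        rw [ENNReal.tsum_mul_left, ENNReal.tsum_add]
    _ ≤ _ := by gcongr <;> exact h _

lemma lintegral_ebracket_mul_le {r s : ℝ} (hr : 0 ≤ r) (hs : 0 ≤ s) (hrs : 1 < r + s) :
    ∃ C : ℝ≥0∞, C ≠ ⊤ ∧ ∀ a b : ℝ, ∫⁻ x : ℝ, ⟪x - a⟫ ^ (-r) * ⟪x - b⟫ ^ (-s) ≤ C := by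
  obtain ⟨C, hC, h⟩ := lintegral_ebracket_rpow_le hrs
  refine ⟨C + C, by finiteness, fun a b => ?_⟩
  calc ∫⁻ x : ℝ, ⟪x - a⟫ ^ (-r) * ⟪x - b⟫ ^ (-s)
      ≤ ∫⁻ x : ℝ, ⟪x - a⟫ ^ (-(r + s)) + ⟪x - b⟫ ^ (-(r + s)) := by
        refine lintegral_mono fun x => ?_
        rw [neg_add]
        exact ebracket_rpow_mul_rpow_le _ _ (neg_nonpos.mpr hr) (neg_nonpos.mpr hs)
    _ = (∫⁻ x : ℝ, ⟪x - a⟫ ^ (-(r + s))) + ∫⁻ x : ℝ, ⟪x - b⟫ ^ (-(r + s)) :=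
        lintegral_add_left (by fun_prop) _
    _ ≤ C + C := add_le_add (h a) (h b)

lemma lintegral_ebracket_mul_le_rpow {r s t : ℝ} (ht : 0 ≤ t) (ht1 : t ≤ 1) (hr : t ≤ r)
    (hs : t ≤ s) (hrst : 1 < r + s - t) :
    ∃ C : ℝ≥0∞, C ≠ ⊤ ∧ ∀ a b : ℝ,
      ∫⁻ x : ℝ, ⟪x - a⟫ ^ (-r) * ⟪x - b⟫ ^ (-s) ≤ C * ⟪a - b⟫ ^ (-t) := by
  obtain ⟨C₁, hC₁, h₁⟩ := lintegral_ebracket_mul_le (r := r - t) (s := s) (by linarith)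
    (by linarith) (by linarith)
  obtain ⟨C₂, hC₂, h₂⟩ := lintegral_ebracket_mul_le (r := r) (s := s - t) (by linarith)
    (by linarith) (by linarith)
  refine ⟨C₁ + C₂, by finiteness, fun a b => ?_⟩
  have h_pointwise : ∀ x : ℝ, ⟪a - b⟫ ^ t * (⟪x - a⟫ ^ (-r) * ⟪x - b⟫ ^ (-s)) ≤
      ⟪x - a⟫ ^ (-(r - t)) * ⟪x - b⟫ ^ (-s) + ⟪x - a⟫ ^ (-r) * ⟪x - b⟫ ^ (-(s - t)) := by
    intro x
    have h_triangle : ⟪a - b⟫ ^ t ≤ ⟪x - a⟫ ^ t + ⟪x - b⟫ ^ t := by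
      refine (ENNReal.rpow_le_rpow ?_ ht).trans (ENNReal.rpow_add_le_add_rpow _ _ ht ht1)
      rw [ebracket_sub_comm x a, ← sub_add_sub_cancel a x b]
      exact ebracket_add_le _ _
    rw [show -(r - t) = t + -r by ring, show -(s - t) = t + -s by ring, ebracket_rpow_add,
      ebracket_rpow_add]
    exact (mul_le_mul_left h_triangle _).trans_eq (by ring)
  rw [ENNReal.rpow_neg, ← div_eq_mul_inv,
    ENNReal.le_div_iff_mul_le (.inl (ebracket_rpow_ne_zero _ _)) (.inl (ebracket_rpow_ne_top _ _)),
    mul_comm, ← lintegral_const_mul _ (by fun_prop)]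
  refine (lintegral_mono h_pointwise).trans ?_
  rw [lintegral_add_left (by fun_prop)]
  exact add_le_add (h₁ a b) (h₂ a b)

/-- Counting measure times Lebesgue measure on the space-time frequencies `(k, τ) ∈ ℤ × ℝ`. -/
noncomputable abbrev stVol : Measure (ℤ × ℝ) := (Measure.count : Measure ℤ).prod volume

instance : (stVol).IsNegInvariant where
  neg_eq_self := (Measure.measurePreserving_neg Measure.count).prod
    (Measure.measurePreserving_neg volume) |>.map_eq

lemma lintegral_stVol {f : ℤ × ℝ → ℝ≥0∞} (hf : Measurable f) :
    ∫⁻ x, f x ∂stVol = ∑' k : ℤ, ∫⁻ τ : ℝ, f (k, τ) := by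
  rw [lintegral_prod _ hf.aemeasurable, lintegral_count]

lemma add_sq_le (x y : ℝ≥0∞) : (x + y) ^ 2 ≤ 2 * (x ^ 2 + y ^ 2) := by
  have h := ENNReal.rpow_add_le_mul_rpow_add_rpow x y one_le_two
  norm_num at h
  exact h

section CauchySchwarz

lemma sq_lintegral_mul_le {X : Type*} [MeasurableSpace X] (μ : Measure X) {f g : X → ℝ≥0∞}
    (hf : AEMeasurable f μ) (hg : AEMeasurable g μ) :
    (∫⁻ x, f x * g x ∂μ) ^ 2 ≤ (∫⁻ x, f x ^ 2 ∂μ) * ∫⁻ x, g x ^ 2 ∂μ := by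
  have h_sqrt : ∀ t : ℝ≥0∞, (t ^ (1 / 2 : ℝ)) ^ 2 = t := fun t => by
    rw [← ENNReal.rpow_mul_natCast]; norm_num
  have h := pow_le_pow_left' (ENNReal.lintegral_mul_le_Lp_mul_Lq μ .two_two hf hg) 2
  simpa only [Pi.mul_apply, mul_pow, h_sqrt, ENNReal.rpow_two] using h

variable {k : ℤ × ℝ → ℤ × ℝ → ℝ≥0∞} {f g : ℤ × ℝ → ℝ≥0∞} {D : ℝ≥0∞}

/-- The bilinear convolution `∫ k(x - z, z) f(x - z) g(z) dz` with multiplier `k` on `ℤ × ℝ`. -/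
noncomputable def bilinConv (k : ℤ × ℝ → ℤ × ℝ → ℝ≥0∞) (f g : ℤ × ℝ → ℝ≥0∞) (x : ℤ × ℝ) : ℝ≥0∞ :=
  ∫⁻ z, k (x - z) z * (f (x - z) * g z) ∂stVol

@[fun_prop]
lemma measurable_bilinConv (hk : Measurable k.uncurry) (hf : Measurable f) (hg : Measurable g) :
    Measurable (bilinConv k f g) :=
  Measurable.lintegral_prod_right (by fun_prop)

lemma lintegral_lintegral_sub (hk : Measurable k.uncurry) :
    ∫⁻ x, ∫⁻ z, k (x - z) z ∂stVol ∂stVol = ∫⁻ y, ∫⁻ z, k y z ∂stVol ∂stVol := by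
  rw [lintegral_lintegral_swap (by fun_prop), lintegral_lintegral_swap hk.aemeasurable]
  exact lintegral_congr fun z => lintegral_sub_right_eq_self (fun y => k y z) z

lemma lintegral_sq_bilinConv_le_of_output (hk : Measurable k.uncurry) (hf : Measurable f)
    (hg : Measurable g) (hD : ∀ x, ∫⁻ z, k (x - z) z ^ 2 ∂stVol ≤ D) :
    ∫⁻ x, bilinConv k f g x ^ 2 ∂stVol ≤
      D * ((∫⁻ y, f y ^ 2 ∂stVol) * ∫⁻ z, g z ^ 2 ∂stVol) := by
  have h_fibre : ∀ x, bilinConv k f g x ^ 2 ≤ D * ∫⁻ z, f (x - z) ^ 2 * g z ^ 2 ∂stVol := by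
    intro x
    refine (sq_lintegral_mul_le stVol (by fun_prop) (by fun_prop)).trans ?_
    simp only [mul_pow]
    gcongr
    exact hD x
  refine (lintegral_mono h_fibre).trans_eq ?_
  rw [lintegral_const_mul _ (Measurable.lintegral_prod_right (by fun_prop)),
    lintegral_lintegral_sub (k := fun y z => f y ^ 2 * g z ^ 2) (by fun_prop)]
  simp only [lintegral_const_mul _ (hg.pow_const 2), lintegral_mul_const _ (hf.pow_const 2)]

lemma lintegral_sq_bilinConv_le_of_left (hk : Measurable k.uncurry) (hf : Measurable f)
    (hg : Measurable g) (hD : ∀ y, ∫⁻ z, k y z ^ 2 ∂stVol ≤ D) :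
    ∫⁻ x, bilinConv k f g x ^ 2 ∂stVol ≤
      D * ((∫⁻ y, f y ^ 2 ∂stVol) * ∫⁻ z, g z ^ 2 ∂stVol) := by
  have h_fibre : ∀ x, bilinConv k f g x ^ 2 ≤
      (∫⁻ z, f (x - z) ^ 2 * k (x - z) z ^ 2 ∂stVol) * ∫⁻ z, g z ^ 2 ∂stVol := by
    intro x
    simpa only [bilinConv, mul_pow, mul_left_comm, mul_assoc] using
      sq_lintegral_mul_le stVol (f := fun z => f (x - z) * k (x - z) z) (by fun_prop)
        hg.aemeasurable
  refine (lintegral_mono h_fibre).trans ?_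
  rw [lintegral_mul_const _ (Measurable.lintegral_prod_right (by fun_prop)),
    lintegral_lintegral_sub (k := fun y z => f y ^ 2 * k y z ^ 2) (by fun_prop), ← mul_assoc,
    ← lintegral_const_mul D (hf.pow_const 2)]
  refine mul_le_mul_left (lintegral_mono fun y => ?_) _
  rw [lintegral_const_mul _ (by fun_prop), mul_comm]
  exact mul_le_mul_left (hD y) _

lemma lintegral_sq_bilinConv_le_of_right (hk : Measurable k.uncurry) (hf : Measurable f)
    (hg : Measurable g) (hD : ∀ z, ∫⁻ y, k y z ^ 2 ∂stVol ≤ D) :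
    ∫⁻ x, bilinConv k f g x ^ 2 ∂stVol ≤
      D * ((∫⁻ y, f y ^ 2 ∂stVol) * ∫⁻ z, g z ^ 2 ∂stVol) := by
  have h_swap : bilinConv k f g = bilinConv (fun y z => k z y) g f := by
    ext x
    rw [bilinConv, ← lintegral_sub_left_eq_self _ x]
    simp only [sub_sub_cancel, bilinConv, mul_comm (g _)]
  rw [h_swap, mul_comm (lintegral _ _)]
  exact lintegral_sq_bilinConv_le_of_left (by fun_prop) hg hf hD

lemma tsum_sq_lintegral_bilinConv_le (hk : Measurable k.uncurry) (hf : Measurable f)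
    (hg : Measurable g)
    (hD : ∀ l : ℤ, ∫⁻ τ : ℝ, ∫⁻ z, k ((l, τ) - z) z ^ 2 ∂stVol ≤ D) :
    ∑' l : ℤ, (∫⁻ τ : ℝ, bilinConv k f g (l, τ)) ^ 2 ≤
      D * ((∫⁻ y, f y ^ 2 ∂stVol) * ∫⁻ z, g z ^ 2 ∂stVol) := by
  have h_fibre : ∀ l : ℤ, (∫⁻ τ : ℝ, bilinConv k f g (l, τ)) ^ 2 ≤
      D * ∫⁻ τ : ℝ, ∫⁻ z, f ((l, τ) - z) ^ 2 * g z ^ 2 ∂stVol := by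
    intro l
    have h_cs := sq_lintegral_mul_le ((volume : Measure ℝ).prod stVol)
      (f := fun p => k ((l, p.1) - p.2) p.2) (g := fun p => f ((l, p.1) - p.2) * g p.2)
      (by fun_prop) (by fun_prop)
    rw [lintegral_prod _ (by fun_prop), lintegral_prod _ (by fun_prop),
      lintegral_prod _ (by fun_prop)] at h_cs
    simp only [mul_pow] at h_cs
    exact h_cs.trans (mul_le_mul_left (hD l) _)
  refine (ENNReal.tsum_le_tsum h_fibre).trans_eq ?_
  rw [ENNReal.tsum_mul_left,
    ← lintegral_stVol (f := fun x => ∫⁻ z, f (x - z) ^ 2 * g z ^ 2 ∂stVol)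
      (Measurable.lintegral_prod_right (by fun_prop)),
    lintegral_lintegral_sub (k := fun y z => f y ^ 2 * g z ^ 2) (by fun_prop)]
  simp only [lintegral_const_mul _ (hg.pow_const 2), lintegral_mul_const _ (hf.pow_const 2)]

end CauchySchwarz

section Modulations

/-- The weight `⟨m(k, τ)⟩` of a modulation function `m`. -/
noncomputable def modWeight (m : ℤ → ℝ → ℝ) (x : ℤ × ℝ) : ℝ≥0∞ := ⟪m x.1 x.2⟫

/-- The modulation function `m` of a dispersion relation with at most two branches: for each `k`,
`|m(k, τ)|` is the distance from `τ` to one of two points. -/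
structure IsTwoBranched (m : ℤ → ℝ → ℝ) : Prop where
  measurable : Measurable m.uncurry
  exists_branches : ∀ k, ∃ p p' : ℝ, ∀ τ, |m k τ| = |τ - p| ∨ |m k τ| = |τ - p'|

variable {m : ℤ → ℝ → ℝ}

lemma IsTwoBranched.measurable_modWeight (hm : IsTwoBranched m) : Measurable (modWeight m) :=
  measurable_ebracket.comp hm.measurable

lemma IsTwoBranched.exists_rpow_le (hm : IsTwoBranched m) (k : ℤ) :
    ∃ p p' : ℝ, ∀ τ a : ℝ, modWeight m (k, τ) ^ a ≤ ⟪τ - p⟫ ^ a + ⟪τ - p'⟫ ^ a := by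
  obtain ⟨p, p', h⟩ := hm.exists_branches k
  refine ⟨p, p', fun τ a => ?_⟩
  rcases h τ with h | h <;> rw [modWeight, ebracket_congr_abs h]
  exacts [le_self_add, le_add_self]

lemma IsTwoBranched.lintegral_rpow_le (hm : IsTwoBranched m) {r : ℝ} (hr : 1 < r) :
    ∃ C : ℝ≥0∞, C ≠ ⊤ ∧ ∀ k, ∫⁻ τ : ℝ, modWeight m (k, τ) ^ (-r) ≤ C := by
  obtain ⟨C, hC, h⟩ := lintegral_ebracket_rpow_le hr
  refine ⟨C + C, by finiteness, fun k => ?_⟩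
  obtain ⟨p, p', hp⟩ := hm.exists_rpow_le k
  refine (lintegral_mono fun τ => hp τ (-r)).trans ?_
  rw [lintegral_add_left (by fun_prop)]
  exact add_le_add (h p) (h p')

/-- The modulation `m(-k, -τ)` of a conjugated function. -/
def reflect (m : ℤ → ℝ → ℝ) (k : ℤ) (τ : ℝ) : ℝ := m (-k) (-τ)

lemma modWeight_reflect (x : ℤ × ℝ) : modWeight (reflect m) x = modWeight m (-x) := rfl

lemma IsTwoBranched.reflect (hm : IsTwoBranched m) : IsTwoBranched (reflect m) where
  measurable := hm.measurable.comp measurable_neg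
  exists_branches k := by
    obtain ⟨p, p', h⟩ := hm.exists_branches (-k)
    refine ⟨-p, -p', fun τ => ?_⟩
    rw [Zakharov.reflect, ← abs_neg (τ - -p), ← abs_neg (τ - -p'), neg_sub', neg_sub', neg_neg,
      neg_neg]
    simpa only [sub_neg_eq_add, neg_neg] using h (-τ)

lemma isTwoBranched_modS (α : ℝ) : IsTwoBranched (modS α) where
  measurable := by
    have : Measurable fun k : ℤ => (k : ℝ) := measurable_from_top
    unfold modS Function.uncurry
    fun_prop
  exists_branches k := ⟨α * k ^ 2, α * k ^ 2, fun _ => .inl rfl⟩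

lemma abs_modW_eq_or (β : ℝ) (k : ℤ) (τ : ℝ) :
    |modW β k τ| = |τ - β * k| ∨ |modW β k τ| = |τ - -(β * k)| := by
  unfold modW
  rcases abs_choice τ with hτ | hτ <;> rcases abs_choice (k : ℝ) with hk | hk <;> rw [hτ, hk]
  · exact .inl rfl
  · right; congr 1; ring
  · right; rw [← abs_neg]; congr 1; ring
  · left; rw [← abs_neg]; congr 1; ring

lemma isTwoBranched_modW (β : ℝ) : IsTwoBranched (modW β) where
  measurable := by
    have : Measurable fun k : ℤ => (k : ℝ) := measurable_from_top
    have : Measurable fun x : ℝ => |x| := measurable_norm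
    unfold modW Function.uncurry
    fun_prop
  exists_branches k := ⟨β * k, -(β * k), fun τ => abs_modW_eq_or β k τ⟩

end Modulations

section KernelBounds

lemma lintegral_ebracket_mul_modW_le (β : ℝ) :
    ∃ C : ℝ≥0∞, C ≠ ⊤ ∧ ∀ (a : ℝ) (q : ℤ),
      ∫⁻ σ : ℝ, ⟪σ - a⟫ ^ (-(3 / 4) : ℝ) * modWeight (modW β) (q, σ) ^ (-(3 / 4) : ℝ) ≤
        C * (⟪a - β * q⟫ ^ (-(1 / 4) : ℝ) + ⟪a + β * q⟫ ^ (-(1 / 4) : ℝ)) := by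
  obtain ⟨C, hC, h⟩ := lintegral_ebracket_mul_le_rpow (r := 3 / 4) (s := 3 / 4) (t := 1 / 4)
    (by norm_num) (by norm_num) (by norm_num) (by norm_num) (by norm_num)
  refine ⟨C, hC, fun a q => ?_⟩
  calc _ ≤ ∫⁻ σ : ℝ, ⟪σ - a⟫ ^ (-(3 / 4) : ℝ) * ⟪σ - β * q⟫ ^ (-(3 / 4) : ℝ) +
        ⟪σ - a⟫ ^ (-(3 / 4) : ℝ) * ⟪σ - -(β * q)⟫ ^ (-(3 / 4) : ℝ) := by
        refine lintegral_mono fun σ => ?_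
        rcases abs_modW_eq_or β q σ with hσ | hσ <;> simp only [modWeight, ebracket_congr_abs hσ]
        exacts [le_self_add, le_add_self]
    _ ≤ _ := by
        rw [lintegral_add_left (by fun_prop), mul_add, ← sub_neg_eq_add a]
        exact add_le_add (h _ _) (h _ _)

lemma ebracket_inv_mul_rpow_le (u v : ℝ) :
    ⟪u⟫⁻¹ * ⟪v⟫ ^ (-(1 / 4) : ℝ) ≤ ⟪u⟫ ^ (-(3 / 2) : ℝ) + ⟪v⟫ ^ (-(3 / 4) : ℝ) := by
  have h_conj : Real.HolderConjugate (3 / 2) 3 := by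
    rw [Real.holderConjugate_iff]; norm_num
  refine (ENNReal.young_inequality _ _ h_conj).trans (add_le_add ?_ ?_)
  · refine (ENNReal.div_le_of_le_mul ?_)
    rw [ENNReal.inv_rpow, ← ENNReal.rpow_neg]
    exact le_mul_of_one_le_right' (ENNReal.one_le_ofReal.mpr (by norm_num))
  · refine (ENNReal.div_le_of_le_mul ?_)
    rw [← ENNReal.rpow_mul, show -(1 / 4 : ℝ) * 3 = -(3 / 4) by norm_num]
    exact le_mul_of_one_le_right' (ENNReal.one_le_ofReal.mpr (by norm_num))

lemma tsum_lintegral_modW_le (β : ℝ) {d : ℝ} (hd : 0 < d) :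
    ∃ C : ℝ≥0∞, C ≠ ⊤ ∧ ∀ a b c e l : ℝ, d ≤ |a| → 1 ≤ |e| →
      ∑' q : ℤ, ⟪e * q + l⟫⁻¹ * ∫⁻ σ : ℝ, ⟪σ - (a * q ^ 2 + b * q + c)⟫ ^ (-(3 / 4) : ℝ) *
        modWeight (modW β) (q, σ) ^ (-(3 / 4) : ℝ) ≤ C := by
  obtain ⟨C₁, hC₁, h_conv⟩ := lintegral_ebracket_mul_modW_le β
  obtain ⟨C₂, hC₂, h_lin⟩ := tsum_ebracket_linear_rpow_le (r := 3 / 2) (by norm_num) one_pos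
  obtain ⟨C₃, hC₃, h_quad⟩ := tsum_ebracket_quadratic_rpow_le (r := 3 / 4) (by norm_num) hd
  refine ⟨C₁ * ((C₂ + C₃) + (C₂ + C₃)), by finiteness, fun a b c e l ha he => ?_⟩
  have h_branch : ∀ b' : ℝ, ∑' q : ℤ, ⟪e * q + l⟫⁻¹ * ⟪a * q ^ 2 + b' * q + c⟫ ^ (-(1 / 4) : ℝ) ≤
      C₂ + C₃ := fun b' => by
    refine (ENNReal.tsum_le_tsum fun q => ebracket_inv_mul_rpow_le _ _).trans ?_
    rw [ENNReal.tsum_add]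
    exact add_le_add (h_lin e l he) (h_quad a b' c ha)
  calc _ ≤ ∑' q : ℤ, C₁ * (⟪e * q + l⟫⁻¹ * ⟪a * q ^ 2 + (b - β) * q + c⟫ ^ (-(1 / 4) : ℝ) +
          ⟪e * q + l⟫⁻¹ * ⟪a * q ^ 2 + (b + β) * q + c⟫ ^ (-(1 / 4) : ℝ)) := by
        refine ENNReal.tsum_le_tsum fun q => (mul_le_mul_right (h_conv _ q) _).trans_eq ?_
        rw [show a * (q : ℝ) ^ 2 + b * q + c - β * q = a * q ^ 2 + (b - β) * q + c by ring,
          show a * (q : ℝ) ^ 2 + b * q + c + β * q = a * q ^ 2 + (b + β) * q + c by ring]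
        ring
    _ ≤ _ := by
        rw [ENNReal.tsum_mul_left, ENNReal.tsum_add]
        exact mul_le_mul_right (add_le_add (h_branch _) (h_branch _)) _

/-- The gain `⟨k + l⟩⁻¹` in an interaction of Schrödinger frequencies `k = j + q`, `l = j` with a
wave frequency `q ≠ 0`. -/
noncomputable def schroedingerGain (j q : ℤ) : ℝ≥0∞ := if q = 0 then 0 else ⟪2 * j + q⟫⁻¹

lemma schroedingerGain_le (j q : ℤ) : schroedingerGain j q ≤ ⟪2 * j + q⟫⁻¹ := by
  unfold schroedingerGain
  split_ifs
  exacts [zero_le, le_rfl]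

lemma schroedingerGain_rpow_le (j q : ℤ) {r : ℝ} (hr : 0 ≤ r) :
    schroedingerGain j q ^ r ≤ ⟪2 * j + q⟫ ^ (-r) := by
  rw [ENNReal.rpow_neg, ← ENNReal.inv_rpow]
  exact ENNReal.rpow_le_rpow (schroedingerGain_le j q) hr

variable {α : ℝ}

lemma lintegral_output_kernel_le (hα : α ≠ 0) (β : ℝ) :
    ∃ C : ℝ≥0∞, C ≠ ⊤ ∧ ∀ x : ℤ × ℝ, ∫⁻ z, schroedingerGain (x - z).1 z.1 *
      (modWeight (modS α) (x - z) ^ (-(3 / 4) : ℝ) * modWeight (modW β) z ^ (-(3 / 4) : ℝ))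
        ∂stVol ≤ C := by
  obtain ⟨C, hC, h⟩ := tsum_lintegral_modW_le β (abs_pos.mpr hα)
  refine ⟨C, hC, fun x => ?_⟩
  have hS := (isTwoBranched_modS α).measurable_modWeight
  have hW := (isTwoBranched_modW β).measurable_modWeight
  rw [lintegral_stVol (by fun_prop)]
  refine le_trans (ENNReal.tsum_le_tsum fun q => ?_)
    (h (-α) (2 * α * x.1) (x.2 - α * x.1 ^ 2) (-1) (2 * x.1) (by rw [abs_neg]) (by simp))
  rw [← lintegral_const_mul _ (by fun_prop)]
  refine lintegral_mono fun σ => mul_le_mul' ((schroedingerGain_le _ _).trans_eq ?_)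
    (mul_le_mul_left (le_of_eq ?_) _)
  · push_cast [Prod.fst_sub]
    congr 2
    ring
  · simp only [modWeight, modS, Prod.fst_sub, Prod.snd_sub]
    rw [← ebracket_neg]
    push_cast
    congr 2
    ring

lemma lintegral_left_kernel_le (hα : α ≠ 0) (β : ℝ) :
    ∃ C : ℝ≥0∞, C ≠ ⊤ ∧ ∀ y : ℤ × ℝ, ∫⁻ z, schroedingerGain y.1 z.1 *
      (modWeight (modS α) (y + z) ^ (-(3 / 4) : ℝ) * modWeight (modW β) z ^ (-(3 / 4) : ℝ))
        ∂stVol ≤ C := by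
  obtain ⟨C, hC, h⟩ := tsum_lintegral_modW_le β (abs_pos.mpr hα)
  refine ⟨C, hC, fun y => ?_⟩
  have hS := (isTwoBranched_modS α).measurable_modWeight
  have hW := (isTwoBranched_modW β).measurable_modWeight
  rw [lintegral_stVol (by fun_prop)]
  refine le_trans (ENNReal.tsum_le_tsum fun q => ?_)
    (h α (2 * α * y.1) (α * y.1 ^ 2 - y.2) 1 (2 * y.1) le_rfl (by simp))
  rw [← lintegral_const_mul _ (by fun_prop)]
  refine lintegral_mono fun σ => mul_le_mul' ((schroedingerGain_le _ _).trans_eq ?_)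
    (mul_le_mul_left (le_of_eq ?_) _)
  · congr 2
    ring
  · simp only [modWeight, modS, Prod.fst_add, Prod.snd_add]
    push_cast
    congr 2
    ring

lemma lintegral_modS_mul_modS_le (α : ℝ) :
    ∃ C : ℝ≥0∞, C ≠ ⊤ ∧ ∀ (n : ℤ) (z : ℤ × ℝ),
      ∫⁻ σ : ℝ, modWeight (modS α) ((n, σ) + z) ^ (-(3 / 4) : ℝ) *
        modWeight (modS α) (n, σ) ^ (-(3 / 4) : ℝ) ≤
          C * ⟪-(2 * α * z.1) * n + (z.2 - α * z.1 ^ 2)⟫ ^ (-(1 / 4) : ℝ) := by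
  obtain ⟨C, hC, h⟩ := lintegral_ebracket_mul_le_rpow (r := 3 / 4) (s := 3 / 4) (t := 1 / 4)
    (by norm_num) (by norm_num) (by norm_num) (by norm_num) (by norm_num)
  refine ⟨C, hC, fun n z => ?_⟩
  convert h (α * (n + z.1) ^ 2 - z.2) (α * n ^ 2) using 2
  · ext σ
    simp only [modWeight, modS, Prod.fst_add, Prod.snd_add]
    push_cast
    congr 3
    ring
  · rw [← ebracket_neg]
    congr 2
    ring

lemma lintegral_right_kernel_le (hα : α ≠ 0) :
    ∃ C : ℝ≥0∞, C ≠ ⊤ ∧ ∀ z : ℤ × ℝ, ∫⁻ y, schroedingerGain y.1 z.1 *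
      (modWeight (modS α) (y + z) ^ (-(3 / 4) : ℝ) * modWeight (modS α) y ^ (-(3 / 4) : ℝ))
        ∂stVol ≤ C := by
  obtain ⟨C₁, hC₁, h_conv⟩ := lintegral_modS_mul_modS_le α
  obtain ⟨C₂, hC₂, h_lin⟩ := tsum_ebracket_linear_rpow_le (r := 5 / 4) (by norm_num)
    (show 0 < min 2 (2 * |α|) by positivity)
  refine ⟨C₁ * (C₂ + C₂), by finiteness, fun z => ?_⟩
  have hS := (isTwoBranched_modS α).measurable_modWeight
  rw [lintegral_stVol (by fun_prop)]
  rcases eq_or_ne z.1 0 with hz | hz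
  · simp [schroedingerGain, hz]
  have hz_abs : 2 * |α| ≤ |-(2 * α * (z.1 : ℝ))| := by
    rw [abs_neg, abs_mul, abs_mul, abs_two]
    exact le_mul_of_one_le_right (by positivity) (mod_cast Int.one_le_abs hz)
  calc _ ≤ ∑' n : ℤ, C₁ * (⟪2 * n + z.1⟫ ^ (-(5 / 4) : ℝ) +
          ⟪-(2 * α * z.1) * n + (z.2 - α * z.1 ^ 2)⟫ ^ (-(5 / 4) : ℝ)) := by
        refine ENNReal.tsum_le_tsum fun n => ?_
        dsimp only
        rw [lintegral_const_mul _ (by fun_prop)]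
        refine (mul_le_mul' (schroedingerGain_le n z.1) (h_conv n z)).trans ?_
        rw [mul_left_comm, ← ENNReal.rpow_neg_one, show -(5 / 4 : ℝ) = -1 + -(1 / 4) by norm_num]
        gcongr
        exact ebracket_rpow_mul_rpow_le _ _ (by norm_num) (by norm_num)
    _ ≤ _ := by
        rw [ENNReal.tsum_mul_left, ENNReal.tsum_add]
        gcongr
        · exact h_lin _ _ (by simp)
        · exact h_lin _ _ ((min_le_right _ _).trans hz_abs)

end KernelBounds

section Resonance

lemma exists_mul_bracket_le_abs_sub {θ : ℝ} (hθ : ∀ m : ℤ, θ ≠ m) :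
    ∃ c : ℝ, 0 < c ∧ ∀ n : ℤ, c * bracket n ≤ |n - θ| := by
  set d := |θ - round θ|
  have hd : 0 < d := abs_pos.mpr (sub_ne_zero.mpr (hθ _))
  refine ⟨d / (1 + d + |θ|), by positivity, fun n => ?_⟩
  have hdn : d ≤ |n - θ| := abs_sub_comm (n : ℝ) θ ▸ round_le θ n
  have h_bracket : bracket n ≤ 1 + |(n : ℝ) - θ| + |θ| := by
    have h := abs_add_le ((n : ℝ) - θ) θ
    rw [sub_add_cancel] at h
    linarith [bracket_le_one_add_abs n]
  rw [div_mul_eq_mul_div, div_le_iff₀ (by positivity)]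
  calc d * bracket n ≤ d * (1 + |(n : ℝ) - θ| + |θ|) := by gcongr
    _ ≤ |(n : ℝ) - θ| * (1 + d + |θ|) := by nlinarith [abs_nonneg θ]

variable {α β : ℝ}

lemma abs_resonance_le_modulations (hα : α ≠ 0) (y z : ℤ × ℝ) :
    |α * z.1 * (2 * y.1 + z.1 - β / α)| ≤
        |modS α (y + z).1 (y + z).2| + |modS α y.1 y.2| + |modW β z.1 z.2| ∨
      |α * z.1 * (2 * y.1 + z.1 - -(β / α))| ≤
        |modS α (y + z).1 (y + z).2| + |modS α y.1 y.2| + |modW β z.1 z.2| := by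
  have h_diff : ∀ b c : ℝ, α * b = c →
      |α * z.1 * (2 * y.1 + z.1 - b)| ≤
        |modS α (y + z).1 (y + z).2| + |modS α y.1 y.2| + |z.2 - c * z.1| := by
    rintro b _ rfl
    have h_id : α * z.1 * (2 * y.1 + z.1 - b) =
        modS α y.1 y.2 - modS α (y + z).1 (y + z).2 + (z.2 - α * b * z.1) := by
      simp only [modS, Prod.fst_add, Prod.snd_add]
      push_cast
      ring
    rw [h_id, add_comm |modS α (y + z).1 _|]
    exact (abs_add_le _ _).trans (add_le_add_left (abs_sub _ _) _)
  rcases abs_modW_eq_or β z.1 z.2 with h | h <;> rw [h]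
  · exact .inl (h_diff _ β (mul_div_cancel₀ β hα))
  · rw [← neg_mul]
    exact .inr (h_diff _ (-β) (by rw [mul_neg, mul_div_cancel₀ β hα]))

lemma exists_mul_bracket_le_modulations (hα : α ≠ 0) (hαβ : ∀ m : ℤ, β / α ≠ m) :
    ∃ c : ℝ, 0 < c ∧ ∀ y z : ℤ × ℝ, z.1 ≠ 0 → c * (bracket z.1 * bracket (2 * y.1 + z.1)) ≤
      |modS α (y + z).1 (y + z).2| + |modS α y.1 y.2| + |modW β z.1 z.2| := by
  obtain ⟨c₁, hc₁, h₁⟩ := exists_mul_bracket_le_abs_sub hαβ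
  obtain ⟨c₂, hc₂, h₂⟩ := exists_mul_bracket_le_abs_sub (θ := -(β / α)) fun m h =>
    hαβ (-m) (by rw [Int.cast_neg, ← h, neg_neg])
  have : 0 < |α| := abs_pos.mpr hα
  refine ⟨|α| * min c₁ c₂ / 2, by positivity, fun y z hz => ?_⟩
  have hz_bracket : bracket z.1 ≤ 2 * |(z.1 : ℝ)| := by
    have : (1 : ℝ) ≤ |(z.1 : ℝ)| := mod_cast Int.one_le_abs hz
    linarith [bracket_le_one_add_abs z.1]
  have h_lower : ∀ {c b : ℝ}, min c₁ c₂ ≤ c → (∀ n : ℤ, c * bracket n ≤ |n - b|) →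
      |α| * min c₁ c₂ / 2 * (bracket z.1 * bracket (2 * y.1 + z.1)) ≤
        |α * z.1 * (2 * y.1 + z.1 - b)| := by
    intro c b hc h
    have hb := h (2 * y.1 + z.1)
    push_cast at hb
    have h_pos := bracket_pos (2 * y.1 + z.1)
    calc |α| * min c₁ c₂ / 2 * (bracket z.1 * bracket (2 * y.1 + z.1))
        ≤ |α| * min c₁ c₂ / 2 * (2 * |(z.1 : ℝ)| * bracket (2 * y.1 + z.1)) := by gcongr
      _ = |α| * |(z.1 : ℝ)| * (min c₁ c₂ * bracket (2 * y.1 + z.1)) := by ring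
      _ ≤ |α| * |(z.1 : ℝ)| * |2 * y.1 + z.1 - b| := by
          gcongr
          exact (mul_le_mul_of_nonneg_right hc h_pos.le).trans hb
      _ = _ := by rw [abs_mul, abs_mul]
  exact (abs_resonance_le_modulations hα y z).elim (h_lower (min_le_left _ _) h₁).trans
    (h_lower (min_le_right _ _) h₂).trans

lemma exists_ebracket_le_modulations (hα : α ≠ 0) (hαβ : ∀ m : ℤ, β / α ≠ m) :
    ∃ C : ℝ≥0∞, C ≠ ⊤ ∧ ∀ y z : ℤ × ℝ, z.1 ≠ 0 →
      ⟪z.1⟫ ≤ C * ⟪2 * y.1 + z.1⟫⁻¹ *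
        (modWeight (modS α) (y + z) + modWeight (modS α) y + modWeight (modW β) z) := by
  obtain ⟨c, hc, h⟩ := exists_mul_bracket_le_modulations hα hαβ
  refine ⟨ENNReal.ofReal c⁻¹, ENNReal.ofReal_ne_top, fun y z hz => ?_⟩
  rw [mul_right_comm, ← div_eq_mul_inv, ENNReal.le_div_iff_mul_le
    (.inl (ebracket_ne_zero _)) (.inl (ebracket_ne_top _))]
  simp only [modWeight, ebracket]
  rw [← ENNReal.ofReal_mul (bracket_pos _).le,
    ← ENNReal.ofReal_add (bracket_pos _).le (bracket_pos _).le,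
    ← ENNReal.ofReal_add (add_pos (bracket_pos _) (bracket_pos _)).le (bracket_pos _).le,
    ← ENNReal.ofReal_mul (by positivity)]
  refine ENNReal.ofReal_le_ofReal ?_
  rw [← div_eq_inv_mul, le_div_iff₀' hc]
  exact (h y z hz).trans
    (add_le_add_three (abs_le_bracket _) (abs_le_bracket _) (abs_le_bracket _))

end Resonance

section NonresonantInteraction

/-- A quadratic interaction with multiplier `M(j, l)`, input modulations `m₁` (at frequency `j`) and
`m₂` (at frequency `l`) and output modulation `m₀` (at frequency `j + l`).  The resonance function
dominates `M² / κ`, and for `b = 3 / 8` the gain `κ` makes the product of any two of the weights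
`⟨mᵢ⟩^{-b}` square integrable along the convolution, with the third frequency fixed. -/
structure NonresonantInteraction (M κ : ℤ → ℤ → ℝ≥0∞) (m₀ m₁ m₂ : ℤ → ℝ → ℝ) : Prop where
  isTwoBranched₀ : IsTwoBranched m₀
  isTwoBranched₁ : IsTwoBranched m₁
  isTwoBranched₂ : IsTwoBranched m₂
  multiplier : ∀ j l, M j l = 0 ∨ 1 ≤ M j l
  resonance : ∃ C : ℝ≥0∞, C ≠ ⊤ ∧ ∀ y z : ℤ × ℝ, M y.1 z.1 ^ 2 ≤
    C * κ y.1 z.1 * (modWeight m₀ (y + z) + modWeight m₁ y + modWeight m₂ z)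
  output : ∃ C : ℝ≥0∞, C ≠ ⊤ ∧ ∀ x : ℤ × ℝ, ∫⁻ z, κ (x - z).1 z.1 *
    (modWeight m₁ (x - z) ^ (-(3 / 4) : ℝ) * modWeight m₂ z ^ (-(3 / 4) : ℝ)) ∂stVol ≤ C
  left : ∃ C : ℝ≥0∞, C ≠ ⊤ ∧ ∀ y : ℤ × ℝ, ∫⁻ z, κ y.1 z.1 *
    (modWeight m₀ (y + z) ^ (-(3 / 4) : ℝ) * modWeight m₂ z ^ (-(3 / 4) : ℝ)) ∂stVol ≤ C
  right : ∃ C : ℝ≥0∞, C ≠ ⊤ ∧ ∀ z : ℤ × ℝ, ∫⁻ y, κ y.1 z.1 *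
    (modWeight m₀ (y + z) ^ (-(3 / 4) : ℝ) * modWeight m₁ y ^ (-(3 / 4) : ℝ)) ∂stVol ≤ C

variable {M κ : ℤ → ℤ → ℝ≥0∞} {m₀ m₁ m₂ : ℤ → ℝ → ℝ}

-- By duality the output of one interaction is the second input of the other one; the first input
-- enters the dual interaction conjugated.
lemma NonresonantInteraction.rotate (h : NonresonantInteraction M κ m₀ m₁ m₂) :
    NonresonantInteraction (fun j l => M (-l) (j + l)) (fun j l => κ (-l) (j + l))
      m₂ m₀ (reflect m₁) where
  isTwoBranched₀ := h.isTwoBranched₂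
  isTwoBranched₁ := h.isTwoBranched₀
  isTwoBranched₂ := h.isTwoBranched₁.reflect
  multiplier j l := h.multiplier (-l) (j + l)
  resonance := by
    obtain ⟨C, hC, h_res⟩ := h.resonance
    refine ⟨C, hC, fun y z => (h_res (-z) (y + z)).trans_eq ?_⟩
    simp only [modWeight_reflect, neg_add_cancel_comm_assoc, Prod.fst_neg, Prod.fst_add]
    ring
  output := by
    obtain ⟨C, hC, h_right⟩ := h.right
    refine ⟨C, hC, fun x => ?_⟩
    rw [← lintegral_neg_eq_self]
    simpa [modWeight_reflect, add_comm x] using h_right x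
  left := by
    obtain ⟨C, hC, h_output⟩ := h.output
    refine ⟨C, hC, fun y => ?_⟩
    rw [← lintegral_sub_right_eq_self _ y]
    simpa [modWeight_reflect, mul_comm] using h_output y
  right := by
    obtain ⟨C, hC, h_left⟩ := h.left
    refine ⟨C, hC, fun z => ?_⟩
    rw [← lintegral_sub_right_eq_self _ z]
    simpa [neg_add_eq_sub, mul_comm] using h_left (-z)

lemma nonresonantInteraction_schroedinger_wave {α β : ℝ} (hα : α ≠ 0)
    (hαβ : ∀ m : ℤ, β / α ≠ m) :
    NonresonantInteraction (fun _ q => if q = 0 then 0 else ⟪q⟫ ^ (1 / 2 : ℝ)) schroedingerGain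
      (modS α) (modS α) (modW β) where
  isTwoBranched₀ := isTwoBranched_modS α
  isTwoBranched₁ := isTwoBranched_modS α
  isTwoBranched₂ := isTwoBranched_modW β
  multiplier _ q := by
    split_ifs
    exacts [.inl rfl, .inr (ENNReal.one_le_rpow (one_le_ebracket _) (by norm_num))]
  resonance := by
    obtain ⟨C, hC, h⟩ := exists_ebracket_le_modulations hα hαβ
    refine ⟨C, hC, fun y z => ?_⟩
    rcases eq_or_ne z.1 0 with hz | hz
    · simp [hz]
    · simpa [hz, schroedingerGain, ← ENNReal.rpow_mul_natCast] using h y z hz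
  output := lintegral_output_kernel_le hα β
  left := lintegral_left_kernel_le hα β
  right := lintegral_right_kernel_le hα

end NonresonantInteraction

section TripleProduct

lemma mul_mul_le_add_rpow (a b c : ℝ≥0∞) :
    a * (b * c) ≤ (a * b) ^ (3 / 2 : ℝ) + (b * c) ^ (3 / 2 : ℝ) + (a * c) ^ (3 / 2 : ℝ) := by
  have h_smallest : ∀ {x y z : ℝ≥0∞}, z ≤ x → z ≤ y → x * y * z ≤ (x * y) ^ (3 / 2 : ℝ) := by
    intro x y z hx hy
    have hz : z ≤ (x * y) ^ (1 / 2 : ℝ) := by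
      simpa [← ENNReal.rpow_natCast_mul] using
        ENNReal.rpow_le_rpow ((sq z).trans_le (mul_le_mul' hx hy)) (z := 1 / 2) (by norm_num)
    calc x * y * z ≤ x * y * (x * y) ^ (1 / 2 : ℝ) := by gcongr
      _ = (x * y) ^ (3 / 2 : ℝ) := by
          nth_rw 1 [← ENNReal.rpow_one (x * y)]
          rw [← ENNReal.rpow_add_of_nonneg _ _ (by norm_num) (by norm_num)]
          norm_num
  rcases le_total a b with hab | hba
  · rcases le_total a c with hac | hca
    · rw [mul_comm a]
      exact le_add_right (le_add_left (h_smallest hab hac))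
    · rw [← mul_assoc]
      exact le_add_right (le_add_right (h_smallest hca (hca.trans hab)))
  · rcases le_total b c with hbc | hcb
    · rw [mul_left_comm, mul_comm b]
      exact le_add_left (h_smallest hba hbc)
    · rw [← mul_assoc]
      exact le_add_right (le_add_right (h_smallest (hcb.trans hba) hcb))

lemma lintegral_lintegral_mul_mul_le {a b c : ℝ → ℝ≥0∞} (ha : Measurable a) (hb : Measurable b)
    (hc : Measurable c) :
    ∫⁻ τ, ∫⁻ σ, a τ * (b (τ - σ) * c σ) ≤
      (∫⁻ τ, a τ ^ (3 / 2 : ℝ)) * (∫⁻ τ, b τ ^ (3 / 2 : ℝ)) +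
        (∫⁻ τ, b τ ^ (3 / 2 : ℝ)) * (∫⁻ τ, c τ ^ (3 / 2 : ℝ)) +
        (∫⁻ τ, a τ ^ (3 / 2 : ℝ)) * ∫⁻ τ, c τ ^ (3 / 2 : ℝ) := by
  have h_ab : ∫⁻ τ, ∫⁻ σ, (a τ * b (τ - σ)) ^ (3 / 2 : ℝ) =
      (∫⁻ τ, a τ ^ (3 / 2 : ℝ)) * ∫⁻ τ, b τ ^ (3 / 2 : ℝ) := by
    rw [← lintegral_mul_const _ (by fun_prop)]
    refine lintegral_congr fun τ => ?_
    simp only [ENNReal.mul_rpow_of_nonneg _ _ (show (0 : ℝ) ≤ 3 / 2 by norm_num)]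
    rw [lintegral_const_mul _ (by fun_prop),
      lintegral_sub_left_eq_self (fun σ => b σ ^ (3 / 2 : ℝ)) τ]
  have h_bc : ∫⁻ τ, ∫⁻ σ, (b (τ - σ) * c σ) ^ (3 / 2 : ℝ) =
      (∫⁻ τ, b τ ^ (3 / 2 : ℝ)) * ∫⁻ τ, c τ ^ (3 / 2 : ℝ) := by
    rw [lintegral_lintegral_swap (by fun_prop), ← lintegral_const_mul _ (by fun_prop)]
    refine lintegral_congr fun σ => ?_
    simp only [ENNReal.mul_rpow_of_nonneg _ _ (show (0 : ℝ) ≤ 3 / 2 by norm_num)]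
    rw [lintegral_mul_const _ (by fun_prop),
      lintegral_sub_right_eq_self (fun τ => b τ ^ (3 / 2 : ℝ)) σ]
  have h_ac : ∫⁻ τ, ∫⁻ σ, (a τ * c σ) ^ (3 / 2 : ℝ) =
      (∫⁻ τ, a τ ^ (3 / 2 : ℝ)) * ∫⁻ τ, c τ ^ (3 / 2 : ℝ) := by
    simp only [ENNReal.mul_rpow_of_nonneg _ _ (show (0 : ℝ) ≤ 3 / 2 by norm_num)]
    exact lintegral_lintegral_mul (by fun_prop) (by fun_prop)
  refine (lintegral_mono fun τ => lintegral_mono fun σ =>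
    mul_mul_le_add_rpow (a τ) (b (τ - σ)) (c σ)).trans_eq ?_
  rw [lintegral_congr fun τ => (lintegral_add_right _ (by fun_prop)).trans
      (congrArg (· + _) (lintegral_add_right _ (by fun_prop))),
    lintegral_add_right _ (Measurable.lintegral_prod_right (by fun_prop)),
    lintegral_add_right _ (Measurable.lintegral_prod_right (by fun_prop)), h_ab, h_bc, h_ac]

variable {m₀ m₁ m₂ : ℤ → ℝ → ℝ}

lemma IsTwoBranched.lintegral_triple_le (h₀ : IsTwoBranched m₀) (h₁ : IsTwoBranched m₁)
    (h₂ : IsTwoBranched m₂) :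
    ∃ C : ℝ≥0∞, C ≠ ⊤ ∧ ∀ k j l : ℤ, ∫⁻ τ : ℝ, ∫⁻ σ : ℝ, modWeight m₀ (k, τ) ^ (-(7 / 8) : ℝ) *
      (modWeight m₁ (j, τ - σ) ^ (-(3 / 4) : ℝ) * modWeight m₂ (l, σ) ^ (-(3 / 4) : ℝ)) ≤ C := by
  obtain ⟨C₀, hC₀, hI₀⟩ := h₀.lintegral_rpow_le (r := 21 / 16) (by norm_num)
  obtain ⟨C₁, hC₁, hI₁⟩ := h₁.lintegral_rpow_le (r := 9 / 8) (by norm_num)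
  obtain ⟨C₂, hC₂, hI₂⟩ := h₂.lintegral_rpow_le (r := 9 / 8) (by norm_num)
  refine ⟨C₀ * C₁ + C₁ * C₂ + C₀ * C₂, by finiteness, fun k j l => ?_⟩
  have := h₀.measurable_modWeight
  have := h₁.measurable_modWeight
  have := h₂.measurable_modWeight
  refine (lintegral_lintegral_mul_mul_le (a := fun τ => modWeight m₀ (k, τ) ^ (-(7 / 8) : ℝ))
    (b := fun τ => modWeight m₁ (j, τ) ^ (-(3 / 4) : ℝ))
    (c := fun τ => modWeight m₂ (l, τ) ^ (-(3 / 4) : ℝ))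
    (by fun_prop) (by fun_prop) (by fun_prop)).trans ?_
  simp only [← ENNReal.rpow_mul]
  norm_num only [neg_mul]
  gcongr
  exacts [hI₀ k, hI₁ j, hI₁ j, hI₂ l, hI₀ k, hI₂ l]

end TripleProduct

section BilinearEstimate

/-- `⟨m⟩^a f`. -/
noncomputable def weighted (m : ℤ → ℝ → ℝ) (a : ℝ) (f : ℤ × ℝ → ℝ≥0∞) (x : ℤ × ℝ) : ℝ≥0∞ :=
  modWeight m x ^ a * f x

/-- The squared `L²` norm of `⟨m⟩^{a / 2} f`. -/
noncomputable def modEnergy (m : ℤ → ℝ → ℝ) (a : ℝ) (f : ℤ × ℝ → ℝ≥0∞) : ℝ≥0∞ :=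
  ∫⁻ x, modWeight m x ^ a * f x ^ 2 ∂stVol

lemma IsTwoBranched.measurable_weighted {m : ℤ → ℝ → ℝ} (hm : IsTwoBranched m) (a : ℝ)
    {f : ℤ × ℝ → ℝ≥0∞} (hf : Measurable f) : Measurable (weighted m a f) :=
  (hm.measurable_modWeight.pow_const a).mul hf

lemma lintegral_sq_weighted (m : ℤ → ℝ → ℝ) (a : ℝ) (f : ℤ × ℝ → ℝ≥0∞) :
    ∫⁻ x, weighted m a f x ^ 2 ∂stVol = modEnergy m (2 * a) f := by
  simp only [weighted, modEnergy, mul_pow, ← ENNReal.rpow_mul_natCast, Nat.cast_ofNat, mul_comm a]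

lemma modEnergy_mono (m : ℤ → ℝ → ℝ) {a b : ℝ} (hab : a ≤ b) (f : ℤ × ℝ → ℝ≥0∞) :
    modEnergy m a f ≤ modEnergy m b f :=
  lintegral_mono fun _ => mul_le_mul_left
    (ENNReal.rpow_le_rpow_of_exponent_le (one_le_ebracket _) hab) _

/-- The bilinear convolution with multiplier `M` maps `X^{0,1/2} × X^{0,1/2}` into
`X^{0,-1/2} ∩ ℓ²_k L¹_τ(⟨m₀⟩⁻¹)`, with a weaker power of the modulation on one of the factors;
it is this weaker power that gains a power of `T` on functions localized to `[0, T]`. -/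
def BilinearEstimate (M : ℤ → ℤ → ℝ≥0∞) (m₀ m₁ m₂ : ℤ → ℝ → ℝ) : Prop :=
  ∃ C : ℝ≥0∞, C ≠ ⊤ ∧ ∀ f g : ℤ × ℝ → ℝ≥0∞, Measurable f → Measurable g →
    ∫⁻ x, (modWeight m₀ x ^ (-(1 / 2) : ℝ) *
        bilinConv (fun y z => M y.1 z.1) f g x) ^ 2 ∂stVol ≤
      C * (modEnergy m₁ 1 f * modEnergy m₂ (3 / 4) g +
        modEnergy m₁ (3 / 4) f * modEnergy m₂ 1 g) ∧
    ∑' k : ℤ, (∫⁻ τ : ℝ, (modWeight m₀ (k, τ))⁻¹ *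
        bilinConv (fun y z => M y.1 z.1) f g (k, τ)) ^ 2 ≤
      C * (modEnergy m₁ 1 f * modEnergy m₂ (3 / 4) g +
        modEnergy m₁ (3 / 4) f * modEnergy m₂ 1 g)

lemma sq_rpow_mul_rpow_mul_rpow (κ v w : ℝ≥0∞) (a b c : ℝ) :
    (κ ^ a * (v ^ b * w ^ c)) ^ 2 = κ ^ (2 * a) * (v ^ (2 * b) * w ^ (2 * c)) := by
  simp only [mul_pow, ← ENNReal.rpow_mul_natCast, Nat.cast_ofNat, mul_comm _ (2 : ℝ)]

lemma le_rpow_add_of_sq_le {M κ w₀ w₁ w₂ C : ℝ≥0∞} {θ : ℝ} (hM : M = 0 ∨ 1 ≤ M) (hθ : 1 / 2 ≤ θ)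
    (h : M ^ 2 ≤ C * κ * (w₀ + w₁ + w₂)) :
    M ≤ ((3 * C) ^ θ + (3 * C) ^ (1 / 2 : ℝ)) *
      ((κ * w₀) ^ θ + ((κ * w₁) ^ (1 / 2 : ℝ) + (κ * w₂) ^ (1 / 2 : ℝ))) := by
  rcases hM with rfl | hM
  · exact zero_le
  have h_power : ∀ {w : ℝ≥0∞} {r : ℝ}, w₀ ≤ w → w₁ ≤ w → w₂ ≤ w → 1 / 2 ≤ r →
      M ≤ (3 * C) ^ r * (κ * w) ^ r := by
    intro w r h₀ h₁ h₂ hr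
    calc M = M ^ (1 : ℝ) := (ENNReal.rpow_one M).symm
      _ ≤ M ^ (2 * r) := ENNReal.rpow_le_rpow_of_exponent_le hM (by linarith)
      _ = (M ^ 2) ^ r := by rw [ENNReal.rpow_mul, ENNReal.rpow_two]
      _ ≤ (3 * C * (κ * w)) ^ r := by
          refine ENNReal.rpow_le_rpow (h.trans ?_) (by linarith)
          calc C * κ * (w₀ + w₁ + w₂) ≤ C * κ * (w + w + w) := by gcongr
            _ = 3 * C * (κ * w) := by ring
      _ = _ := ENNReal.mul_rpow_of_nonneg _ _ (by linarith)
  obtain ⟨h₁, h₂⟩ | ⟨h₀, h₂⟩ | ⟨h₀, h₁⟩ :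
      w₁ ≤ w₀ ∧ w₂ ≤ w₀ ∨ w₀ ≤ w₁ ∧ w₂ ≤ w₁ ∨ w₀ ≤ w₂ ∧ w₁ ≤ w₂ := by grind
  · exact (h_power le_rfl h₁ h₂ hθ).trans (mul_le_mul' le_self_add le_self_add)
  · exact (h_power h₀ le_rfl h₂ le_rfl).trans
      (mul_le_mul' le_add_self (le_add_left le_self_add))
  · exact (h_power h₀ h₁ le_rfl le_rfl).trans
      (mul_le_mul' le_add_self (le_add_left le_add_self))

variable {M κ : ℤ → ℤ → ℝ≥0∞} {m₀ m₁ m₂ : ℤ → ℝ → ℝ}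

/-- The part of a nonresonant interaction in which the output has the largest modulation, with a
power `⟨m₀⟩^θ` split off. -/
noncomputable def outputPart (κ : ℤ → ℤ → ℝ≥0∞) (m₁ m₂ : ℤ → ℝ → ℝ) (θ : ℝ)
    (f g : ℤ × ℝ → ℝ≥0∞) : ℤ × ℝ → ℝ≥0∞ :=
  bilinConv (fun y z => κ y.1 z.1 ^ θ *
      (modWeight m₁ y ^ (-(3 / 8) : ℝ) * modWeight m₂ z ^ (-(3 / 8) : ℝ)))
    (weighted m₁ (3 / 8) f) (weighted m₂ (3 / 8) g)

/-- The part of a nonresonant interaction in which one of the two inputs has the largest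
modulation, with a power `⟨m₀⟩^{3/8}` split off. -/
noncomputable def inputPart (κ : ℤ → ℤ → ℝ≥0∞) (m₀ m₁ m₂ : ℤ → ℝ → ℝ) (f g : ℤ × ℝ → ℝ≥0∞)
    (x : ℤ × ℝ) : ℝ≥0∞ :=
  bilinConv (fun y z => κ y.1 z.1 ^ (1 / 2 : ℝ) *
      (modWeight m₀ (y + z) ^ (-(3 / 8) : ℝ) * modWeight m₂ z ^ (-(3 / 8) : ℝ)))
    (weighted m₁ (1 / 2) f) (weighted m₂ (3 / 8) g) x +
  bilinConv (fun y z => κ y.1 z.1 ^ (1 / 2 : ℝ) *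
      (modWeight m₀ (y + z) ^ (-(3 / 8) : ℝ) * modWeight m₁ y ^ (-(3 / 8) : ℝ)))
    (weighted m₁ (3 / 8) f) (weighted m₂ (1 / 2) g) x

lemma mul_bilinConv (w : ℤ × ℝ → ℝ≥0∞) {k : ℤ × ℝ → ℤ × ℝ → ℝ≥0∞} (hk : Measurable k.uncurry)
    {f g : ℤ × ℝ → ℝ≥0∞} (hf : Measurable f) (hg : Measurable g) (x : ℤ × ℝ) :
    w x * bilinConv k f g x = bilinConv (fun y z => w (y + z) * k y z) f g x := by
  simp only [bilinConv]
  rw [← lintegral_const_mul _ (by fun_prop)]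
  simp only [sub_add_cancel, mul_assoc]

lemma IsTwoBranched.tsum_sq_lintegral_rpow_mul_le (h₀ : IsTwoBranched m₀) {r : ℝ} (hr : 1 / 2 < r) :
    ∃ C : ℝ≥0∞, C ≠ ⊤ ∧ ∀ f : ℤ × ℝ → ℝ≥0∞, Measurable f →
      ∑' k : ℤ, (∫⁻ τ : ℝ, modWeight m₀ (k, τ) ^ (-r) * f (k, τ)) ^ 2 ≤
        C * ∫⁻ x, f x ^ 2 ∂stVol := by
  obtain ⟨C, hC, h_weight⟩ := h₀.lintegral_rpow_le (r := 2 * r) (by linarith)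
  refine ⟨C, hC, fun f hf => ?_⟩
  have hm₀ := h₀.measurable_modWeight
  rw [lintegral_stVol (by fun_prop), ← ENNReal.tsum_mul_left]
  refine ENNReal.tsum_le_tsum fun k =>
    (sq_lintegral_mul_le volume (by fun_prop) (by fun_prop)).trans (mul_le_mul_left ?_ _)
  simpa only [← ENNReal.rpow_mul_natCast, Nat.cast_ofNat, neg_mul, mul_comm r] using h_weight k

namespace NonresonantInteraction

lemma bilinConv_le (h : NonresonantInteraction M κ m₀ m₁ m₂) {θ : ℝ} (hθ : 1 / 2 ≤ θ) :
    ∃ C : ℝ≥0∞, C ≠ ⊤ ∧ ∀ f g : ℤ × ℝ → ℝ≥0∞, Measurable f → Measurable g → ∀ x,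
      bilinConv (fun y z => M y.1 z.1) f g x ≤ C *
        (modWeight m₀ x ^ θ * outputPart κ m₁ m₂ θ f g x +
          modWeight m₀ x ^ (3 / 8 : ℝ) * inputPart κ m₀ m₁ m₂ f g x) := by
  obtain ⟨C, hC, h_res⟩ := h.resonance
  refine ⟨(3 * C) ^ θ + (3 * C) ^ (1 / 2 : ℝ), ?_, fun f g hf hg x => ?_⟩
  · have : 0 ≤ θ := by linarith
    finiteness
  have hm₀ := h.isTwoBranched₀.measurable_modWeight
  have hm₁ := h.isTwoBranched₁.measurable_modWeight
  have hm₂ := h.isTwoBranched₂.measurable_modWeight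
  have hκ : Measurable κ.uncurry := .of_discrete
  have h_cancel : ∀ (m : ℤ → ℝ → ℝ) (a : ℝ) (y : ℤ × ℝ),
      modWeight m y ^ (-a) * modWeight m y ^ a = 1 := fun m a y => by
    rw [modWeight, ← ebracket_rpow_add, neg_add_cancel, ENNReal.rpow_zero]
  unfold outputPart inputPart bilinConv weighted
  rw [← lintegral_add_left (by fun_prop), ← lintegral_const_mul _ (by fun_prop),
    ← lintegral_const_mul _ (by fun_prop), ← lintegral_add_left (by fun_prop),
    ← lintegral_const_mul _ (by fun_prop)]
  refine lintegral_mono fun z => (mul_le_mul_left (le_rpow_add_of_sq_le (h.multiplier _ _) hθ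
    (h_res (x - z) z)) _).trans_eq ?_
  rw [sub_add_cancel, mul_assoc]
  congr 1
  simp only [ENNReal.mul_rpow_of_nonneg _ _ (show (0 : ℝ) ≤ 1 / 2 by norm_num),
    ENNReal.mul_rpow_of_nonneg _ _ (show 0 ≤ θ by linarith)]
  set y := x - z
  have hyz : y + z = x := sub_add_cancel x z
  set w := modWeight
  symm
  calc _ = (w m₁ y ^ (-(3 / 8) : ℝ) * w m₁ y ^ (3 / 8 : ℝ)) *
          (w m₂ z ^ (-(3 / 8) : ℝ) * w m₂ z ^ (3 / 8 : ℝ)) *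
            (κ y.1 z.1 ^ θ * w m₀ x ^ θ * (f y * g z)) +
        (w m₀ x ^ (-(3 / 8) : ℝ) * w m₀ x ^ (3 / 8 : ℝ)) *
          ((w m₂ z ^ (-(3 / 8) : ℝ) * w m₂ z ^ (3 / 8 : ℝ)) *
              (κ y.1 z.1 ^ (1 / 2 : ℝ) * w m₁ y ^ (1 / 2 : ℝ) * (f y * g z)) +
            (w m₁ y ^ (-(3 / 8) : ℝ) * w m₁ y ^ (3 / 8 : ℝ)) *
              (κ y.1 z.1 ^ (1 / 2 : ℝ) * w m₂ z ^ (1 / 2 : ℝ) * (f y * g z))) := by rw [hyz]; ring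
    _ = _ := by simp only [h_cancel, one_mul, ← add_mul]

lemma measurable_outputPart (h : NonresonantInteraction M κ m₀ m₁ m₂) (θ : ℝ)
    {f g : ℤ × ℝ → ℝ≥0∞} (hf : Measurable f) (hg : Measurable g) :
    Measurable (outputPart κ m₁ m₂ θ f g) := by
  have hm₁ := h.isTwoBranched₁.measurable_modWeight
  have hm₂ := h.isTwoBranched₂.measurable_modWeight
  have hκ : Measurable κ.uncurry := .of_discrete
  unfold outputPart weighted
  exact measurable_bilinConv (by fun_prop) (by fun_prop) (by fun_prop)

lemma measurable_inputPart (h : NonresonantInteraction M κ m₀ m₁ m₂)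
    {f g : ℤ × ℝ → ℝ≥0∞} (hf : Measurable f) (hg : Measurable g) :
    Measurable (inputPart κ m₀ m₁ m₂ f g) := by
  have hm₀ := h.isTwoBranched₀.measurable_modWeight
  have hm₁ := h.isTwoBranched₁.measurable_modWeight
  have hm₂ := h.isTwoBranched₂.measurable_modWeight
  have hκ : Measurable κ.uncurry := .of_discrete
  unfold inputPart weighted
  exact (measurable_bilinConv (by fun_prop) (by fun_prop) (by fun_prop)).add
    (measurable_bilinConv (by fun_prop) (by fun_prop) (by fun_prop))

lemma lintegral_sq_outputPart_le (h : NonresonantInteraction M κ m₀ m₁ m₂) :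
    ∃ C : ℝ≥0∞, C ≠ ⊤ ∧ ∀ f g : ℤ × ℝ → ℝ≥0∞, Measurable f → Measurable g →
      ∫⁻ x, outputPart κ m₁ m₂ (1 / 2) f g x ^ 2 ∂stVol ≤
        C * (modEnergy m₁ (3 / 4) f * modEnergy m₂ (3 / 4) g) := by
  obtain ⟨C, hC, h_output⟩ := h.output
  refine ⟨C, hC, fun f g hf hg => ?_⟩
  have hm₁ := h.isTwoBranched₁.measurable_modWeight
  have hm₂ := h.isTwoBranched₂.measurable_modWeight
  have hκ : Measurable κ.uncurry := .of_discrete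
  refine (lintegral_sq_bilinConv_le_of_output (D := C) (by fun_prop)
    (h.isTwoBranched₁.measurable_weighted _ hf)
    (h.isTwoBranched₂.measurable_weighted _ hg) fun x => ?_).trans_eq ?_
  · simp only [sq_rpow_mul_rpow_mul_rpow]
    convert h_output x using 6 <;> norm_num
  · rw [lintegral_sq_weighted, lintegral_sq_weighted]
    norm_num only

lemma lintegral_sq_inputPart_le (h : NonresonantInteraction M κ m₀ m₁ m₂) :
    ∃ C : ℝ≥0∞, C ≠ ⊤ ∧ ∀ f g : ℤ × ℝ → ℝ≥0∞, Measurable f → Measurable g →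
      ∫⁻ x, inputPart κ m₀ m₁ m₂ f g x ^ 2 ∂stVol ≤
        C * (modEnergy m₁ 1 f * modEnergy m₂ (3 / 4) g +
          modEnergy m₁ (3 / 4) f * modEnergy m₂ 1 g) := by
  obtain ⟨C₁, hC₁, h_left⟩ := h.left
  obtain ⟨C₂, hC₂, h_right⟩ := h.right
  refine ⟨2 * (C₁ + C₂), by finiteness, fun f g hf hg => ?_⟩
  have hm₀ := h.isTwoBranched₀.measurable_modWeight
  have hm₁ := h.isTwoBranched₁.measurable_modWeight
  have hm₂ := h.isTwoBranched₂.measurable_modWeight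
  have hκ : Measurable κ.uncurry := .of_discrete
  have hf' : ∀ a, Measurable (weighted m₁ a f) := fun a =>
    h.isTwoBranched₁.measurable_weighted a hf
  have hg' : ∀ a, Measurable (weighted m₂ a g) := fun a =>
    h.isTwoBranched₂.measurable_weighted a hg
  refine (lintegral_mono fun x => add_sq_le _ _).trans ?_
  rw [lintegral_const_mul _ (by fun_prop), lintegral_add_left (by fun_prop), mul_assoc]
  refine mul_le_mul_right ((add_le_add
    (lintegral_sq_bilinConv_le_of_left (D := C₁) (by fun_prop) (hf' _) (hg' _) fun y => ?_)
    (lintegral_sq_bilinConv_le_of_right (D := C₂) (by fun_prop) (hf' _) (hg' _) fun z => ?_)).trans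
      ?_) 2
  · simp only [sq_rpow_mul_rpow_mul_rpow]
    convert h_left y using 6 <;> norm_num
  · simp only [sq_rpow_mul_rpow_mul_rpow]
    convert h_right z using 6 <;> norm_num
  · simp only [lintegral_sq_weighted]
    norm_num only
    rw [add_mul]
    gcongr
    exacts [le_self_add, le_add_self]

lemma rpow_mul_bilinConv_le (h : NonresonantInteraction M κ m₀ m₁ m₂) {θ : ℝ} (hθ : 1 / 2 ≤ θ)
    (a : ℝ) :
    ∃ C : ℝ≥0∞, C ≠ ⊤ ∧ ∀ f g : ℤ × ℝ → ℝ≥0∞, Measurable f → Measurable g → ∀ x,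
      modWeight m₀ x ^ a * bilinConv (fun y z => M y.1 z.1) f g x ≤ C *
        (modWeight m₀ x ^ (a + θ) * outputPart κ m₁ m₂ θ f g x +
          modWeight m₀ x ^ (a + 3 / 8) * inputPart κ m₀ m₁ m₂ f g x) := by
  obtain ⟨C, hC, h_le⟩ := h.bilinConv_le hθ
  refine ⟨C, hC, fun f g hf hg x => (mul_le_mul_right (h_le f g hf hg x) _).trans_eq ?_⟩
  simp only [modWeight, ebracket_rpow_add]
  ring

lemma lintegral_sq_bilinConv_le (h : NonresonantInteraction M κ m₀ m₁ m₂) :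
    ∃ C : ℝ≥0∞, C ≠ ⊤ ∧ ∀ f g : ℤ × ℝ → ℝ≥0∞, Measurable f → Measurable g →
      ∫⁻ x, (modWeight m₀ x ^ (-(1 / 2) : ℝ) *
          bilinConv (fun y z => M y.1 z.1) f g x) ^ 2 ∂stVol ≤
        C * (modEnergy m₁ 1 f * modEnergy m₂ (3 / 4) g +
          modEnergy m₁ (3 / 4) f * modEnergy m₂ 1 g) := by
  obtain ⟨C, hC, h_le⟩ := h.rpow_mul_bilinConv_le le_rfl (-(1 / 2))
  obtain ⟨C₀, hC₀, h_out⟩ := h.lintegral_sq_outputPart_le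
  obtain ⟨C₁, hC₁, h_in⟩ := h.lintegral_sq_inputPart_le
  refine ⟨C ^ 2 * (2 * (C₀ + C₁)), by finiteness, fun f g hf hg => ?_⟩
  have h_point : ∀ x, (modWeight m₀ x ^ (-(1 / 2) : ℝ) *
      bilinConv (fun y z => M y.1 z.1) f g x) ^ 2 ≤ C ^ 2 * (2 *
        (outputPart κ m₁ m₂ (1 / 2) f g x ^ 2 + inputPart κ m₀ m₁ m₂ f g x ^ 2)) := fun x => by
    refine (pow_le_pow_left' ((h_le f g hf hg x).trans (mul_le_mul_right (add_le_add
      (mul_le_of_le_one_left' (rpow_le_one_of_nonpos (one_le_ebracket _) (by norm_num)))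
      (mul_le_of_le_one_left' (rpow_le_one_of_nonpos (one_le_ebracket _) (by norm_num)))) C))
        2).trans ?_
    rw [mul_pow]
    gcongr
    exact add_sq_le _ _
  refine (lintegral_mono h_point).trans ?_
  have h_meas_out := h.measurable_outputPart (1 / 2) hf hg
  have h_meas_in := h.measurable_inputPart hf hg
  rw [lintegral_const_mul _ (by fun_prop), lintegral_const_mul _ (by fun_prop),
    lintegral_add_left (by fun_prop), mul_assoc, mul_assoc, add_mul]
  gcongr
  · refine (h_out f g hf hg).trans (mul_le_mul_right (le_add_right (mul_le_mul_left ?_ _)) _)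
    exact modEnergy_mono m₁ (by norm_num) f
  · exact h_in f g hf hg

lemma lintegral_lintegral_outputKernel_le (h : NonresonantInteraction M κ m₀ m₁ m₂)
    (hκ : ∃ D : ℝ≥0∞, D ≠ ⊤ ∧ ∀ k, ∑' q, κ (k - q) q ^ (9 / 8 : ℝ) ≤ D) :
    ∃ C : ℝ≥0∞, C ≠ ⊤ ∧ ∀ k : ℤ, ∫⁻ τ : ℝ, ∫⁻ z, modWeight m₀ (k, τ) ^ (-(7 / 8) : ℝ) *
      (κ (k - z.1) z.1 ^ (9 / 8 : ℝ) * (modWeight m₁ ((k, τ) - z) ^ (-(3 / 4) : ℝ) *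
        modWeight m₂ z ^ (-(3 / 4) : ℝ))) ∂stVol ≤ C := by
  obtain ⟨D, hD, hκ⟩ := hκ
  obtain ⟨C, hC, h_triple⟩ := h.isTwoBranched₀.lintegral_triple_le h.isTwoBranched₁
    h.isTwoBranched₂
  refine ⟨D * C, by finiteness, fun k => ?_⟩
  have hm₀ := h.isTwoBranched₀.measurable_modWeight
  have hm₁ := h.isTwoBranched₁.measurable_modWeight
  have hm₂ := h.isTwoBranched₂.measurable_modWeight
  have hκ_meas : Measurable κ.uncurry := .of_discrete
  calc _ = ∑' q, κ (k - q) q ^ (9 / 8 : ℝ) * ∫⁻ τ : ℝ, ∫⁻ σ : ℝ,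
        modWeight m₀ (k, τ) ^ (-(7 / 8) : ℝ) *
          (modWeight m₁ (k - q, τ - σ) ^ (-(3 / 4) : ℝ) *
            modWeight m₂ (q, σ) ^ (-(3 / 4) : ℝ)) := by
        rw [lintegral_congr fun τ => lintegral_stVol (by fun_prop),
          lintegral_tsum fun q => (Measurable.lintegral_prod_right (by fun_prop)).aemeasurable]
        refine tsum_congr fun q => ?_
        rw [← lintegral_const_mul _ (Measurable.lintegral_prod_right (by fun_prop))]
        refine lintegral_congr fun τ => ?_
        rw [← lintegral_const_mul _ (by fun_prop)]
        simp only [mul_left_comm, Prod.mk_sub_mk]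
    _ ≤ ∑' q, κ (k - q) q ^ (9 / 8 : ℝ) * C :=
        ENNReal.tsum_le_tsum fun q => mul_le_mul_right (h_triple k (k - q) q) _
    _ ≤ D * C := by
        rw [ENNReal.tsum_mul_right]
        exact mul_le_mul_left (hκ k) C

lemma tsum_sq_lintegral_outputPart_le (h : NonresonantInteraction M κ m₀ m₁ m₂)
    (hκ : ∃ D : ℝ≥0∞, D ≠ ⊤ ∧ ∀ k, ∑' q, κ (k - q) q ^ (9 / 8 : ℝ) ≤ D) :
    ∃ C : ℝ≥0∞, C ≠ ⊤ ∧ ∀ f g : ℤ × ℝ → ℝ≥0∞, Measurable f → Measurable g →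
      ∑' k : ℤ, (∫⁻ τ : ℝ, modWeight m₀ (k, τ) ^ (-(7 / 16) : ℝ) *
          outputPart κ m₁ m₂ (9 / 16) f g (k, τ)) ^ 2 ≤
        C * (modEnergy m₁ (3 / 4) f * modEnergy m₂ (3 / 4) g) := by
  obtain ⟨C, hC, h_kernel⟩ := h.lintegral_lintegral_outputKernel_le hκ
  refine ⟨C, hC, fun f g hf hg => ?_⟩
  have hm₀ := h.isTwoBranched₀.measurable_modWeight
  have hm₁ := h.isTwoBranched₁.measurable_modWeight
  have hm₂ := h.isTwoBranched₂.measurable_modWeight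
  have hκ_meas : Measurable κ.uncurry := .of_discrete
  have hf' := h.isTwoBranched₁.measurable_weighted (3 / 8) hf
  have hg' := h.isTwoBranched₂.measurable_weighted (3 / 8) hg
  simp only [outputPart]
  simp only [mul_bilinConv (fun x => modWeight m₀ x ^ (-(7 / 16) : ℝ))
    (show Measurable (Function.uncurry fun y z : ℤ × ℝ => κ y.1 z.1 ^ (9 / 16 : ℝ) *
      (modWeight m₁ y ^ (-(3 / 8) : ℝ) * modWeight m₂ z ^ (-(3 / 8) : ℝ))) by fun_prop) hf' hg']
  refine (tsum_sq_lintegral_bilinConv_le (D := C) (by fun_prop) hf' hg' fun k => ?_).trans_eq ?_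
  · simp only [mul_pow, ← ENNReal.rpow_mul_natCast, sub_add_cancel]
    convert h_kernel k using 6 <;> norm_num
  · rw [lintegral_sq_weighted, lintegral_sq_weighted]
    norm_num only

lemma tsum_sq_lintegral_bilinConv_le (h : NonresonantInteraction M κ m₀ m₁ m₂)
    (hκ : ∃ D : ℝ≥0∞, D ≠ ⊤ ∧ ∀ k, ∑' q, κ (k - q) q ^ (9 / 8 : ℝ) ≤ D) :
    ∃ C : ℝ≥0∞, C ≠ ⊤ ∧ ∀ f g : ℤ × ℝ → ℝ≥0∞, Measurable f → Measurable g →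
      ∑' k : ℤ, (∫⁻ τ : ℝ, (modWeight m₀ (k, τ))⁻¹ *
          bilinConv (fun y z => M y.1 z.1) f g (k, τ)) ^ 2 ≤
        C * (modEnergy m₁ 1 f * modEnergy m₂ (3 / 4) g +
          modEnergy m₁ (3 / 4) f * modEnergy m₂ 1 g) := by
  obtain ⟨C, hC, h_le⟩ := h.rpow_mul_bilinConv_le (θ := 9 / 16) (by norm_num) (-1)
  obtain ⟨C₀, hC₀, h_out⟩ := h.tsum_sq_lintegral_outputPart_le hκ
  obtain ⟨C₁, hC₁, h_in⟩ := h.lintegral_sq_inputPart_le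
  obtain ⟨C₂, hC₂, h_sum⟩ := h.isTwoBranched₀.tsum_sq_lintegral_rpow_mul_le (r := 5 / 8)
    (by norm_num)
  refine ⟨C ^ 2 * (2 * (C₀ + C₂ * C₁)), by finiteness, fun f g hf hg => ?_⟩
  have h_meas_out := h.measurable_outputPart (9 / 16) hf hg
  have h_meas_in := h.measurable_inputPart hf hg
  have hm₀ := h.isTwoBranched₀.measurable_modWeight
  norm_num only at h_le
  have h_fibre : ∀ k : ℤ, (∫⁻ τ : ℝ, (modWeight m₀ (k, τ))⁻¹ *
      bilinConv (fun y z => M y.1 z.1) f g (k, τ)) ^ 2 ≤ C ^ 2 * (2 *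
        ((∫⁻ τ : ℝ, modWeight m₀ (k, τ) ^ (-(7 / 16) : ℝ) *
            outputPart κ m₁ m₂ (9 / 16) f g (k, τ)) ^ 2 +
          (∫⁻ τ : ℝ, modWeight m₀ (k, τ) ^ (-(5 / 8) : ℝ) *
            inputPart κ m₀ m₁ m₂ f g (k, τ)) ^ 2)) := fun k => by
    simp only [← ENNReal.rpow_neg_one (modWeight _ _)]
    refine (pow_le_pow_left' (lintegral_mono fun τ => h_le f g hf hg (k, τ)) 2).trans ?_
    rw [lintegral_const_mul _ (by fun_prop), lintegral_add_left (by fun_prop), mul_pow]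
    gcongr
    exact add_sq_le _ _
  refine (ENNReal.tsum_le_tsum h_fibre).trans ?_
  rw [ENNReal.tsum_mul_left, ENNReal.tsum_mul_left, ENNReal.tsum_add, mul_assoc, mul_assoc, add_mul]
  gcongr
  · refine (h_out f g hf hg).trans (mul_le_mul_right (le_add_right (mul_le_mul_left ?_ _)) _)
    exact modEnergy_mono m₁ (by norm_num) f
  · rw [mul_assoc]
    exact (h_sum _ h_meas_in).trans (mul_le_mul_right (h_in f g hf hg) _)

theorem bilinearEstimate (h : NonresonantInteraction M κ m₀ m₁ m₂)
    (hκ : ∃ D : ℝ≥0∞, D ≠ ⊤ ∧ ∀ k, ∑' q, κ (k - q) q ^ (9 / 8 : ℝ) ≤ D) :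
    BilinearEstimate M m₀ m₁ m₂ := by
  obtain ⟨C, hC, h_sq⟩ := h.lintegral_sq_bilinConv_le
  obtain ⟨C', hC', h_lin⟩ := h.tsum_sq_lintegral_bilinConv_le hκ
  refine ⟨C + C', by finiteness, fun f g hf hg => ⟨(h_sq f g hf hg).trans ?_,
    (h_lin f g hf hg).trans ?_⟩⟩
  exacts [mul_le_mul_left le_self_add _, mul_le_mul_left le_add_self _]

end NonresonantInteraction

theorem bilinearEstimate_schroedinger {α β : ℝ} (hα : α ≠ 0) (hαβ : ∀ m : ℤ, β / α ≠ m) :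
    BilinearEstimate (fun _ q => if q = 0 then 0 else ⟪q⟫ ^ (1 / 2 : ℝ))
      (modS α) (modS α) (modW β) := by
  refine (nonresonantInteraction_schroedinger_wave hα hαβ).bilinearEstimate ?_
  obtain ⟨D, hD, h⟩ := tsum_ebracket_linear_rpow_le (r := 9 / 8) (d := 1) (by norm_num) one_pos
  refine ⟨D, hD, fun k => (ENNReal.tsum_le_tsum fun q => ?_).trans (h (-1) (2 * k) (by simp))⟩
  refine (schroedingerGain_rpow_le _ q (by norm_num)).trans_eq ?_
  push_cast
  ring_nf

theorem bilinearEstimate_wave {α β : ℝ} (hα : α ≠ 0) (hαβ : ∀ m : ℤ, β / α ≠ m) :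
    BilinearEstimate (fun j l => if j + l = 0 then 0 else ⟪(j + l : ℤ)⟫ ^ (1 / 2 : ℝ))
      (modW β) (modS α) (reflect (modS α)) := by
  refine (nonresonantInteraction_schroedinger_wave hα hαβ).rotate.bilinearEstimate ?_
  obtain ⟨D, hD, h⟩ := tsum_ebracket_linear_rpow_le (r := 9 / 8) (d := 2) (by norm_num) two_pos
  refine ⟨D, hD, fun k => (ENNReal.tsum_le_tsum fun q => ?_).trans (h (-2) k (by simp))⟩
  refine (schroedingerGain_rpow_le (-q) _ (by norm_num)).trans_eq ?_
  push_cast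
  ring_nf

end BilinearEstimate

section Convolution

variable {G : Type*} [MeasurableSpace G] [AddGroup G] [MeasurableAdd₂ G] [MeasurableNeg G]
  {μ : Measure G} {η f : G → ℝ≥0∞}

lemma sq_lconvolution_le (hη : Measurable η) (hf : Measurable f) (x : G) :
    (η ⋆ₗ[μ] f) x ^ 2 ≤ (∫⁻ y, η y ∂μ) * (η ⋆ₗ[μ] fun y => f y ^ 2) x := by
  have h_sqrt : ∀ t : ℝ≥0∞, t ^ (1 / 2 : ℝ) * t ^ (1 / 2 : ℝ) = t := fun t => by
    rw [← ENNReal.rpow_add_of_nonneg _ _ (by norm_num) (by norm_num)]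
    norm_num
  have h := sq_lintegral_mul_le μ (f := fun y => η y ^ (1 / 2 : ℝ))
    (g := fun y => η y ^ (1 / 2 : ℝ) * f (-y + x)) (by fun_prop) (by fun_prop)
  simpa only [lconvolution_def, ← mul_assoc, mul_pow, sq (_ ^ (1 / 2 : ℝ)), h_sqrt] using h

variable [μ.IsAddLeftInvariant] [SFinite μ]

lemma lintegral_lconvolution (hη : Measurable η) (hf : Measurable f) :
    ∫⁻ x, (η ⋆ₗ[μ] f) x ∂μ = (∫⁻ x, η x ∂μ) * ∫⁻ x, f x ∂μ := by
  simp only [lconvolution_def]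
  rw [lintegral_lintegral_swap (by fun_prop), ← lintegral_mul_const _ hη]
  refine lintegral_congr fun y => ?_
  rw [lintegral_const_mul _ (by fun_prop), lintegral_add_left_eq_self]

lemma lintegral_sq_lconvolution_le (hη : Measurable η) (hf : Measurable f) :
    ∫⁻ x, (η ⋆ₗ[μ] f) x ^ 2 ∂μ ≤ (∫⁻ x, η x ∂μ) ^ 2 * ∫⁻ x, f x ^ 2 ∂μ := by
  refine (lintegral_mono (sq_lconvolution_le hη hf)).trans_eq ?_
  rw [lintegral_const_mul _ (by fun_prop), lintegral_lconvolution hη (by fun_prop), sq, mul_assoc]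

end Convolution

section Localization

lemma lintegral_sq_lconvolution_le' {η f : ℝ → ℝ≥0∞} (hη : Measurable η) (hf : Measurable f) :
    ∫⁻ τ, (η ⋆ₗ f) τ ^ 2 ≤ (∫⁻ σ, η σ ^ 2) * (∫⁻ σ, f σ) ^ 2 := by
  rw [lconvolution_comm, mul_comm]
  exact lintegral_sq_lconvolution_le hf hη

lemma ebracket_rpow_le_of_lipschitz {m : ℝ → ℝ} (hm : LipschitzWith 1 m) (σ τ : ℝ) :
    ⟪m τ⟫ ^ (1 / 2 : ℝ) ≤ ‖τ - σ‖ₑ ^ (1 / 2 : ℝ) + ⟪m σ⟫ ^ (1 / 2 : ℝ) := by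
  refine le_trans ?_ (ENNReal.rpow_add_le_add_rpow _ _ (by norm_num) (by norm_num))
  refine ENNReal.rpow_le_rpow ?_ (by norm_num)
  have h_lip : |m τ - m σ| ≤ |τ - σ| := by simpa [Real.dist_eq] using hm.dist_le_mul τ σ
  have h_bracket := bracket_add_le (m σ) (m τ - m σ)
  rw [add_sub_cancel] at h_bracket
  rw [Real.enorm_eq_ofReal_abs, ebracket, ebracket,
    ← ENNReal.ofReal_add (abs_nonneg _) (bracket_pos _).le]
  exact ENNReal.ofReal_le_ofReal (by linarith)

lemma lintegral_ebracket_mul_sq_lconvolution_le {m : ℝ → ℝ} (hm : LipschitzWith 1 m)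
    {η f : ℝ → ℝ≥0∞} (hη : Measurable η) (hf : Measurable f) :
    ∫⁻ τ, ⟪m τ⟫ * (η ⋆ₗ f) τ ^ 2 ≤
      2 * ((∫⁻ s, ‖s‖ₑ * η s ^ 2) * (∫⁻ σ, f σ) ^ 2 +
        (∫⁻ s, η s) ^ 2 * ∫⁻ σ, ⟪m σ⟫ * f σ ^ 2) := by
  have hm' := hm.continuous.measurable
  have h_sq : ∀ x y : ℝ≥0∞, (x ^ (1 / 2 : ℝ) * y) ^ 2 = x * y ^ 2 := fun x y => by
    rw [mul_pow, ← ENNReal.rpow_mul_natCast]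
    norm_num
  set η' : ℝ → ℝ≥0∞ := fun s => ‖s‖ₑ ^ (1 / 2 : ℝ) * η s with hη'
  set f' : ℝ → ℝ≥0∞ := fun σ => ⟪m σ⟫ ^ (1 / 2 : ℝ) * f σ with hf'
  have h_split : ∀ τ, ⟪m τ⟫ ^ (1 / 2 : ℝ) * (η ⋆ₗ f) τ ≤ (η' ⋆ₗ f) τ + (η ⋆ₗ f') τ := fun τ => by
    simp only [lconvolution_def]
    rw [← lintegral_const_mul _ (by fun_prop), ← lintegral_add_left (by fun_prop)]
    refine lintegral_mono fun s => ?_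
    have h := ebracket_rpow_le_of_lipschitz hm (-s + τ) τ
    rw [show τ - (-s + τ) = s by ring] at h
    calc _ ≤ (‖s‖ₑ ^ (1 / 2 : ℝ) + ⟪m (-s + τ)⟫ ^ (1 / 2 : ℝ)) * (η s * f (-s + τ)) := by gcongr
      _ = _ := by simp only [hη', hf']; ring
  calc _ ≤ ∫⁻ τ, 2 * ((η' ⋆ₗ f) τ ^ 2 + (η ⋆ₗ f') τ ^ 2) := lintegral_mono fun τ => by
          rw [← h_sq]
          exact (pow_le_pow_left' (h_split τ) 2).trans (add_sq_le _ _)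
    _ = 2 * ((∫⁻ τ, (η' ⋆ₗ f) τ ^ 2) + ∫⁻ τ, (η ⋆ₗ f') τ ^ 2) := by
          rw [lintegral_const_mul _ (by fun_prop), lintegral_add_left (by fun_prop)]
    _ ≤ 2 * ((∫⁻ s, η' s ^ 2) * (∫⁻ σ, f σ) ^ 2 + (∫⁻ s, η s) ^ 2 * ∫⁻ σ, f' σ ^ 2) := by
          gcongr
          · exact lintegral_sq_lconvolution_le' (by fun_prop) hf
          · exact lintegral_sq_lconvolution_le hη (by fun_prop)
    _ = _ := by simp only [hη', hf', h_sq]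

lemma rpow_three_quarters_le {w : ℝ≥0∞} (hw₀ : w ≠ 0) (hw : w ≠ ⊤) (δ : ℝ≥0∞) :
    w ^ (3 / 4 : ℝ) ≤ δ ^ (1 / 4 : ℝ) * w + δ ^ (-(3 / 4) : ℝ) := by
  rcases le_total w δ⁻¹ with h | h
  · refine le_trans ?_ le_add_self
    rw [ENNReal.rpow_neg, ← ENNReal.inv_rpow]
    gcongr
  · refine le_trans ?_ le_self_add
    calc w ^ (3 / 4 : ℝ) = w⁻¹ ^ (1 / 4 : ℝ) * w := by
          rw [ENNReal.inv_rpow, ← ENNReal.rpow_neg]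
          nth_rewrite 3 [← ENNReal.rpow_one w]
          rw [← ENNReal.rpow_add _ _ hw₀ hw]
          norm_num
      _ ≤ _ := by
          gcongr
          exact ENNReal.inv_le_iff_inv_le.mp h

/-- The size of a smooth cutoff to the time scale `δ`, in terms of its transform in time, of which
`η` is the absolute value: the transform has mass `O(1)`, and is spread over frequencies
`O(δ⁻¹)`. -/
structure IsCutoffProfile (A δ : ℝ≥0∞) (η : ℝ → ℝ≥0∞) : Prop where
  measurable : Measurable η
  lintegral_le : ∫⁻ s, η s ≤ A
  lintegral_sq_le : ∫⁻ s, η s ^ 2 ≤ A * δ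
  lintegral_enorm_mul_sq_le : ∫⁻ s, ‖s‖ₑ * η s ^ 2 ≤ A

namespace IsCutoffProfile

variable {A δ : ℝ≥0∞} {η : ℝ → ℝ≥0∞} {m : ℝ → ℝ} {f : ℝ → ℝ≥0∞}

lemma lintegral_ebracket_mul_sq_le (hη : IsCutoffProfile A δ η) (hm : LipschitzWith 1 m)
    (hf : Measurable f) :
    ∫⁻ τ, ⟪m τ⟫ * (η ⋆ₗ f) τ ^ 2 ≤
      2 * (A ^ 2 + A) * ((∫⁻ τ, ⟪m τ⟫ * f τ ^ 2) + (∫⁻ τ, f τ) ^ 2) := by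
  calc _ ≤ 2 * (A * (∫⁻ τ, f τ) ^ 2 + A ^ 2 * ∫⁻ τ, ⟪m τ⟫ * f τ ^ 2) := by
        refine (lintegral_ebracket_mul_sq_lconvolution_le hm hη.measurable hf).trans ?_
        gcongr
        exacts [hη.lintegral_enorm_mul_sq_le, hη.lintegral_le]
    _ ≤ 2 * (A * (∫⁻ τ, f τ) ^ 2 + A ^ 2 * ∫⁻ τ, ⟪m τ⟫ * f τ ^ 2) +
          2 * (A * (∫⁻ τ, ⟪m τ⟫ * f τ ^ 2) + A ^ 2 * (∫⁻ τ, f τ) ^ 2) := le_self_add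
    _ = _ := by ring

lemma lintegral_ebracket_rpow_mul_sq_le (hη : IsCutoffProfile A δ η) (hδ₀ : δ ≠ 0) (hδ : δ ≠ ⊤)
    (hm : LipschitzWith 1 m) (hf : Measurable f) :
    ∫⁻ τ, ⟪m τ⟫ ^ (3 / 4 : ℝ) * (η ⋆ₗ f) τ ^ 2 ≤ δ ^ (1 / 4 : ℝ) *
      ((2 * A ^ 2 + 3 * A) * ((∫⁻ τ, ⟪m τ⟫ * f τ ^ 2) + (∫⁻ τ, f τ) ^ 2)) := by
  have hη' := hη.measurable
  have hm' := hm.continuous.measurable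
  have hδ' : δ ^ (-(3 / 4) : ℝ) * δ = δ ^ (1 / 4 : ℝ) := by
    nth_rewrite 2 [← ENNReal.rpow_one δ]
    rw [← ENNReal.rpow_add _ _ hδ₀ hδ]
    norm_num
  calc _ ≤ ∫⁻ τ, (δ ^ (1 / 4 : ℝ) * (⟪m τ⟫ * (η ⋆ₗ f) τ ^ 2) +
          δ ^ (-(3 / 4) : ℝ) * (η ⋆ₗ f) τ ^ 2) := lintegral_mono fun τ => by
        rw [← mul_assoc, ← add_mul]
        exact mul_le_mul_left (rpow_three_quarters_le (ebracket_ne_zero _) (ebracket_ne_top _) δ) _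
    _ = δ ^ (1 / 4 : ℝ) * (∫⁻ τ, ⟪m τ⟫ * (η ⋆ₗ f) τ ^ 2) +
          δ ^ (-(3 / 4) : ℝ) * ∫⁻ τ, (η ⋆ₗ f) τ ^ 2 := by
        rw [lintegral_add_left (by fun_prop), lintegral_const_mul _ (by fun_prop),
          lintegral_const_mul _ (by fun_prop)]
    _ ≤ δ ^ (1 / 4 : ℝ) *
            (2 * (A ^ 2 + A) * ((∫⁻ τ, ⟪m τ⟫ * f τ ^ 2) + (∫⁻ τ, f τ) ^ 2)) +
          δ ^ (-(3 / 4) : ℝ) *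
            ((A * δ) * ((∫⁻ τ, ⟪m τ⟫ * f τ ^ 2) + (∫⁻ τ, f τ) ^ 2)) := by
        gcongr
        · exact hη.lintegral_ebracket_mul_sq_le hm hf
        · refine (lintegral_sq_lconvolution_le' hη' hf).trans ?_
          gcongr
          exacts [hη.lintegral_sq_le, le_add_self]
    _ = _ := by
        rw [mul_comm A δ, mul_assoc δ, ← mul_assoc _ δ, hδ']
        ring

end IsCutoffProfile

/-- The square of the `Y` norm, up to equivalence, of a space-time function whose weighted Fourier
transform `⟨k⟩^s ũ(k, τ)` has absolute value `F`. -/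
noncomputable def yEnergy (m : ℤ → ℝ → ℝ) (F : ℤ × ℝ → ℝ≥0∞) : ℝ≥0∞ :=
  modEnergy m 1 F + ∑' k, (∫⁻ τ, F (k, τ)) ^ 2

lemma modEnergy_le_mul_yEnergy {m : ℤ → ℝ → ℝ} (hm : Measurable m.uncurry)
    {F H : ℤ × ℝ → ℝ≥0∞} (hF : Measurable F) (hH : Measurable H) {a : ℝ} {D : ℝ≥0∞}
    (h : ∀ k, ∫⁻ τ, ⟪m k τ⟫ ^ a * H (k, τ) ^ 2 ≤
      D * ((∫⁻ τ, ⟪m k τ⟫ * F (k, τ) ^ 2) + (∫⁻ τ, F (k, τ)) ^ 2)) :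
    modEnergy m a H ≤ D * yEnergy m F := by
  have : Measurable fun x : ℤ × ℝ => ⟪m x.1 x.2⟫ := by fun_prop
  simp only [modEnergy, yEnergy, modWeight, ENNReal.rpow_one]
  rw [lintegral_stVol (by fun_prop), lintegral_stVol (by fun_prop), ← ENNReal.tsum_add,
    ← ENNReal.tsum_mul_left]
  exact ENNReal.tsum_le_tsum h

/-- Smoothing in `τ`, on the Fourier side of the multiplication by a function of time. -/
noncomputable def timeSmear (η : ℝ → ℝ≥0∞) (F : ℤ × ℝ → ℝ≥0∞) (x : ℤ × ℝ) : ℝ≥0∞ :=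
  (η ⋆ₗ fun τ => F (x.1, τ)) x.2

lemma measurable_timeSmear {η : ℝ → ℝ≥0∞} {F : ℤ × ℝ → ℝ≥0∞} (hη : Measurable η)
    (hF : Measurable F) : Measurable (timeSmear η F) :=
  measurable_from_prod_countable_right fun k => by
    have : Measurable fun τ => F (k, τ) := by fun_prop
    exact measurable_lconvolution _ hη this

namespace IsCutoffProfile

variable {A δ : ℝ≥0∞} {η : ℝ → ℝ≥0∞} {m : ℤ → ℝ → ℝ} {F : ℤ × ℝ → ℝ≥0∞}

lemma modEnergy_one_timeSmear_le (hη : IsCutoffProfile A δ η) (hm : ∀ k, LipschitzWith 1 (m k))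
    (hF : Measurable F) : modEnergy m 1 (timeSmear η F) ≤ (2 * A ^ 2 + 3 * A) * yEnergy m F := by
  refine modEnergy_le_mul_yEnergy (measurable_from_prod_countable_right fun k =>
    (hm k).continuous.measurable) hF (measurable_timeSmear hη.measurable hF) fun k => ?_
  simp only [ENNReal.rpow_one]
  refine (hη.lintegral_ebracket_mul_sq_le (f := fun τ => F (k, τ)) (hm k) (by fun_prop)).trans ?_
  gcongr
  calc 2 * (A ^ 2 + A) ≤ 2 * (A ^ 2 + A) + A := le_self_add
    _ = _ := by ring

lemma modEnergy_three_quarters_timeSmear_le (hη : IsCutoffProfile A δ η) (hδ₀ : δ ≠ 0)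
    (hδ : δ ≠ ⊤) (hm : ∀ k, LipschitzWith 1 (m k)) (hF : Measurable F) :
    modEnergy m (3 / 4) (timeSmear η F) ≤
      δ ^ (1 / 4 : ℝ) * ((2 * A ^ 2 + 3 * A) * yEnergy m F) := by
  rw [← mul_assoc]
  refine modEnergy_le_mul_yEnergy (measurable_from_prod_countable_right fun k =>
    (hm k).continuous.measurable) hF (measurable_timeSmear hη.measurable hF) fun k => ?_
  rw [mul_assoc]
  exact hη.lintegral_ebracket_rpow_mul_sq_le hδ₀ hδ (hm k) (by fun_prop)

end IsCutoffProfile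

end Localization

section InverseFourier

open scoped FourierTransform Convolution ContDiff ComplexConjugate

/-- The inverse Fourier transform in time, without the factor `1 / 2π`.  Up to the name of the
variables, this is also the transform applied to the test functions in `IsSTFourier`. -/
noncomputable def invFourier (f : ℝ → ℂ) (t : ℝ) : ℂ :=
  ∫ τ : ℝ, Complex.exp (Complex.I * τ * t) * f τ

variable {f g : ℝ → ℂ}

lemma invFourier_eq_vectorFourier (f : ℝ → ℂ) :
    invFourier f = VectorFourier.fourierIntegral Real.probChar volume (-LinearMap.mul ℝ ℝ) f := by
  ext t
  rw [VectorFourier.fourierIntegral_probChar]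
  refine integral_congr_ae (.of_forall fun τ => ?_)
  simp only [LinearMap.neg_apply, LinearMap.mul_apply', smul_eq_mul]
  push_cast
  ring_nf

lemma invFourier_eq_fourierInv (f : ℝ → ℂ) (t : ℝ) :
    invFourier f t = 𝓕⁻ f (t / (2 * Real.pi)) := by
  rw [Real.fourierInv_eq', invFourier]
  congr! 3 with τ
  simp only [RCLike.inner_apply, conj_trivial]
  push_cast
  field_simp

lemma norm_invFourier_le (f : ℝ → ℂ) (t : ℝ) : ‖invFourier f t‖ ≤ ∫ τ : ℝ, ‖f τ‖ := by
  rw [invFourier_eq_vectorFourier]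
  exact VectorFourier.norm_fourierIntegral_le_integral_norm _ _ _ _ _

lemma continuous_invFourier (hf : Integrable f) : Continuous (invFourier f) := by
  rw [invFourier_eq_vectorFourier]
  exact VectorFourier.fourierIntegral_continuous Real.continuous_probChar (by fun_prop) hf

lemma invFourier_const_mul (c : ℂ) (f : ℝ → ℂ) (t : ℝ) :
    invFourier (fun τ => c * f τ) t = c * invFourier f t := by
  simp only [invFourier, mul_left_comm _ c, integral_const_mul]

lemma integral_invFourier_mul (hf : Integrable f) (hg : Integrable g) :
    ∫ t, invFourier f t * g t = ∫ τ, f τ * invFourier g τ := by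
  have h_flip : (-LinearMap.mul ℝ ℝ).flip = -LinearMap.mul ℝ ℝ := by
    ext
    simp
  simp only [invFourier_eq_vectorFourier]
  nth_rewrite 2 [← h_flip]
  exact VectorFourier.integral_fourierIntegral_smul_eq_flip Real.continuous_probChar
    (by fun_prop) hf hg

lemma invFourier_convolution (hf : Integrable f) (hg : Integrable g) (t : ℝ) :
    invFourier (f ⋆[ContinuousLinearMap.mul ℂ ℂ] g) t = invFourier f t * invFourier g t := by
  simp only [invFourier_eq_fourierInv, Real.fourierInv_eq_fourier_neg]
  exact Real.fourier_mul_convolution_eq hf hg _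

lemma invFourier_conj_neg (f : ℝ → ℂ) (t : ℝ) :
    invFourier (fun τ => conj (f (-τ))) t = conj (invFourier f t) := by
  rw [invFourier, invFourier, ← integral_conj, ← integral_neg_eq_self]
  refine integral_congr_ae (.of_forall fun τ => ?_)
  simp [← Complex.exp_conj]

lemma invFourier_rescale (f : ℝ → ℂ) {T : ℝ} (hT : 0 < T) (t : ℝ) :
    invFourier (fun τ => T * f (T * τ)) t = invFourier f (t / T) := by
  have hT' : (T : ℂ) ≠ 0 := mod_cast hT.ne'
  calc invFourier (fun τ => T * f (T * τ)) t
      = T * ∫ τ : ℝ, Complex.exp (Complex.I * (T * τ : ℝ) * (t / T : ℝ)) * f (T * τ) := by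
        rw [← integral_const_mul, invFourier]
        refine integral_congr_ae (.of_forall fun τ => ?_)
        dsimp only
        rw [mul_left_comm]
        push_cast
        field_simp
    _ = _ := by
        rw [Measure.integral_comp_mul_left
          (fun σ : ℝ => Complex.exp (Complex.I * σ * (t / T : ℝ)) * f σ) T,
          abs_of_pos (inv_pos.mpr hT), Complex.real_smul, ← mul_assoc, Complex.ofReal_inv,
          mul_inv_cancel₀ hT', one_mul, invFourier]

lemma exists_schwartz_invFourier_eq (ψ : 𝓢(ℝ, ℂ)) : ∃ φ : 𝓢(ℝ, ℂ), invFourier φ = ψ := by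
  have h2π : 2 * Real.pi ≠ 0 := Real.two_pi_pos.ne'
  set χ : 𝓢(ℝ, ℂ) := SchwartzMap.compCLMOfContinuousLinearEquiv ℂ
    (ContinuousLinearEquiv.smulLeft (Units.mk0 (2 * Real.pi) h2π) : ℝ ≃L[ℝ] ℝ) ψ
  refine ⟨𝓕 χ, funext fun t => ?_⟩
  rw [invFourier_eq_fourierInv, ← SchwartzMap.fourierInv_coe,
    FourierTransform.fourierInv_fourier_eq]
  simp only [χ, SchwartzMap.compCLMOfContinuousLinearEquiv_apply, Function.comp_apply,
    ContinuousLinearEquiv.smulLeft_apply_apply, Units.smul_mk0, smul_eq_mul]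
  rw [mul_div_cancel₀ _ h2π]

lemma exists_schwartz_eq_one (R : ℝ) : ∃ ψ : 𝓢(ℝ, ℂ), ∀ t : ℝ, |t| ≤ R → ψ t = 1 := by
  set bump : ContDiffBump (0 : ℝ) := ⟨max R 1, max R 1 + 1, by positivity, by linarith⟩
  have h_supp : HasCompactSupport (Complex.ofRealCLM ∘ bump) :=
    bump.hasCompactSupport.comp_left rfl
  refine ⟨h_supp.toSchwartzMap (Complex.ofRealCLM.contDiff.comp bump.contDiff), fun t ht => ?_⟩
  have h_one : bump t = 1 := bump.one_of_mem_closedBall <| by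
    rw [mem_closedBall_zero_iff, Real.norm_eq_abs]
    exact ht.trans (le_max_left _ _)
  simp [h_one]

end InverseFourier

section SpaceTimeFourier

variable {u : STDist} {f g : ℤ → ℝ → ℂ}

lemma isSTFourier_iff : IsSTFourier u f ↔ ∀ (k : ℤ) (φ : 𝓢(ℝ, ℂ)),
    Integrable (fun τ => f k τ * invFourier φ τ) ∧
      u k φ = (1 / (2 * Real.pi) : ℂ) * ∫ τ, f k τ * invFourier φ τ := by
  simp only [IsSTFourier, invFourier, mul_right_comm Complex.I]

lemma IsSTFourier.integrable_mul (h : IsSTFourier u f) (k : ℤ) (ψ : 𝓢(ℝ, ℂ)) :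
    Integrable fun τ => f k τ * ψ τ := by
  obtain ⟨φ, hφ⟩ := exists_schwartz_invFourier_eq ψ
  exact hφ ▸ (isSTFourier_iff.mp h k φ).1

lemma IsSTFourier.locallyIntegrable (h : IsSTFourier u f) (k : ℤ) : LocallyIntegrable (f k) := by
  rw [locallyIntegrable_iff]
  intro K hK
  obtain ⟨R, hR⟩ := hK.isBounded.exists_norm_le
  obtain ⟨ψ, hψ⟩ := exists_schwartz_eq_one R
  refine (h.integrable_mul k ψ).integrableOn.congr_fun (fun τ hτ => ?_) hK.measurableSet
  simp only [hψ τ (hR τ hτ), mul_one]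

lemma IsSTFourier.ae_eq (hf : IsSTFourier u f) (hg : IsSTFourier u g) (k : ℤ) :
    f k =ᵐ[volume] g k := by
  refine ae_eq_of_integral_contDiff_smul_eq (hf.locallyIntegrable k) (hg.locallyIntegrable k)
    fun ψ hψ hψc => ?_
  have hψc' : HasCompactSupport (Complex.ofRealCLM ∘ ψ) := hψc.comp_left rfl
  obtain ⟨φ, hφ⟩ := exists_schwartz_invFourier_eq
    (hψc'.toSchwartzMap (Complex.ofRealCLM.contDiff.comp hψ))
  have h_eq := ((isSTFourier_iff.mp hf k φ).2.symm.trans (isSTFourier_iff.mp hg k φ).2)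
  have h_pi : (1 / (2 * Real.pi) : ℂ) ≠ 0 := by simp [Real.pi_ne_zero]
  simpa [hφ, mul_comm] using mul_left_cancel₀ h_pi h_eq

lemma isSTFourier_stFourier (h : HasSTFourier u) : IsSTFourier u (stFourier u) := by
  rw [stFourier, dif_pos h]
  exact h.choose_spec

lemma exists_isSTFourier (hf : ∀ k, Integrable (f k)) :
    ∃ u : STDist, IsSTFourier u f ∧ ∀ (k : ℤ) (φ : 𝓢(ℝ, ℂ)),
      u k φ = ∫ t, (1 / (2 * Real.pi) : ℂ) * invFourier (f k) t * φ t := by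
  have h_memLp : ∀ k, MemLp (fun t => (1 / (2 * Real.pi) : ℂ) * invFourier (f k) t) ⊤ := fun k =>
    (memLp_top_of_bound (continuous_invFourier (hf k)).aestronglyMeasurable _
      (.of_forall (norm_invFourier_le (f k)))).const_mul _
  have h_apply : ∀ (k : ℤ) (φ : 𝓢(ℝ, ℂ)), Lp.toTemperedDistribution ((h_memLp k).toLp _) φ =
      ∫ t, (1 / (2 * Real.pi) : ℂ) * invFourier (f k) t * φ t := fun k φ => by
    rw [Lp.toTemperedDistribution_apply]
    refine integral_congr_ae ?_
    filter_upwards [(h_memLp k).coeFn_toLp] with t ht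
    rw [ht, smul_eq_mul, mul_comm]
  refine ⟨fun k => Lp.toTemperedDistribution ((h_memLp k).toLp _),
    isSTFourier_iff.mpr fun k φ => ⟨?_, ?_⟩, h_apply⟩
  · exact (hf k).mul_bdd (continuous_invFourier φ.integrable).aestronglyMeasurable
      (.of_forall (norm_invFourier_le φ))
  · rw [h_apply, ← integral_invFourier_mul (hf k) φ.integrable, ← integral_const_mul]
    simp only [mul_assoc]

end SpaceTimeFourier

section Cutoff

lemma mul_lintegral_comp_mul_left {T : ℝ} (hT : 0 < T) {h : ℝ → ℝ≥0∞} (hh : Measurable h) :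
    ENNReal.ofReal T * ∫⁻ s, h (T * s) = ∫⁻ s, h s := by
  conv_rhs => rw [← Real.smul_map_volume_mul_left hT.ne']
  rw [lintegral_smul_measure, lintegral_map hh (measurable_const_mul T), abs_of_pos hT,
    smul_eq_mul]

lemma lintegral_enorm_mul_sq_ne_top (Ψ : 𝓢(ℝ, ℂ)) : ∫⁻ s, ‖s‖ₑ * ‖Ψ s‖ₑ ^ 2 ≠ ⊤ := by
  have h_int : Integrable fun s => (s * Ψ s) * Ψ s := by
    refine Integrable.mul_bdd (c := SchwartzMap.seminorm ℝ 0 0 Ψ) ?_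
      Ψ.continuous.aestronglyMeasurable (.of_forall fun s => SchwartzMap.norm_le_seminorm ℝ Ψ s)
    rw [← integrable_norm_iff (by fun_prop)]
    simpa using Ψ.integrable_pow_mul volume 1
  convert h_int.2.ne using 3 with s
  rw [enorm_mul, enorm_mul, sq, mul_assoc, ← ofReal_norm (s : ℂ), Complex.norm_real, ofReal_norm]

lemma lintegral_sq_ne_top (Ψ : 𝓢(ℝ, ℂ)) : ∫⁻ s, ‖Ψ s‖ₑ ^ 2 ≠ ⊤ := by
  have h := (Ψ.memLp 2 (μ := volume)).eLpNorm_lt_top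
  rw [eLpNorm_lt_top_iff_lintegral_rpow_enorm_lt_top (by norm_num) (by norm_num)] at h
  simpa using h.ne

lemma isCutoffProfile_rescale {ρ : ℝ → ℝ≥0∞} (hρ : Measurable ρ) {T : ℝ} (hT : 0 < T) :
    IsCutoffProfile ((∫⁻ s, ρ s) + (∫⁻ s, ρ s ^ 2) + ∫⁻ s, ‖s‖ₑ * ρ s ^ 2) (ENNReal.ofReal T)
      (fun s => ENNReal.ofReal T * ρ (T * s)) where
  measurable := by fun_prop
  lintegral_le := by
    rw [lintegral_const_mul _ (by fun_prop), mul_lintegral_comp_mul_left hT hρ, add_assoc]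
    exact le_self_add
  lintegral_sq_le := by
    simp only [mul_pow, sq (ENNReal.ofReal T), mul_assoc]
    rw [lintegral_const_mul _ (by fun_prop), lintegral_const_mul _ (by fun_prop),
      mul_lintegral_comp_mul_left hT (h := fun s => ρ s ^ 2) (by fun_prop), mul_comm]
    gcongr
    exact le_add_self.trans le_self_add
  lintegral_enorm_mul_sq_le := by
    refine le_trans (le_of_eq ?_) le_add_self
    rw [← mul_lintegral_comp_mul_left hT (h := fun s => ‖s‖ₑ * ρ s ^ 2) (by fun_prop),
      ← lintegral_const_mul _ (by fun_prop)]
    refine lintegral_congr fun s => ?_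
    rw [enorm_mul, ← ofReal_norm T, Real.norm_of_nonneg hT.le]
    ring

lemma exists_timeCutoff : ∃ A : ℝ≥0∞, A ≠ ⊤ ∧ ∀ T : ℝ, 0 < T → ∃ η : ℝ → ℂ,
    Integrable η ∧ (∀ t ∈ Set.Ioo 0 T, invFourier η t = 1) ∧
      IsCutoffProfile A (ENNReal.ofReal T) fun τ => ‖η τ‖ₑ := by
  obtain ⟨χ, hχ⟩ := exists_schwartz_eq_one 1
  obtain ⟨Ψ, hΨ⟩ := exists_schwartz_invFourier_eq χ
  refine ⟨_, ENNReal.add_ne_top.mpr ⟨ENNReal.add_ne_top.mpr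
    ⟨(Ψ.integrable (μ := volume)).2.ne, lintegral_sq_ne_top Ψ⟩, lintegral_enorm_mul_sq_ne_top Ψ⟩,
    fun T hT => ⟨fun τ => T * Ψ (T * τ), (Ψ.integrable.comp_mul_left' hT.ne').const_mul _,
      fun t ht => ?_, ?_⟩⟩
  · rw [invFourier_rescale _ hT, hΨ]
    refine hχ _ ?_
    rw [abs_of_pos (div_pos ht.1 hT), div_le_one hT]
    exact ht.2.le
  · convert isCutoffProfile_rescale Ψ.continuous.measurable.enorm hT with τ
    rw [enorm_mul, ← ofReal_norm (T : ℂ), Complex.norm_real, Real.norm_of_nonneg hT.le]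

end Cutoff

section TrigonometricPolynomial

open scoped ComplexConjugate

/-- The trigonometric polynomial in `x` whose spatial Fourier coefficients are `c k t` for `k ∈ A`
and zero otherwise. -/
noncomputable def trigPoly (A : Finset ℤ) (c : ℤ → ℝ → ℂ) (t x : ℝ) : ℂ :=
  (1 / (2 * Real.pi) : ℂ) * ∑ k ∈ A, Complex.exp (Complex.I * k * x) * c k t

variable {A B : Finset ℤ} {c d : ℤ → ℝ → ℂ} {g : ℝ → ℝ → ℂ} {t : ℝ}

lemma exp_I_mul_int_mul_two_pi (k : ℤ) :
    Complex.exp (Complex.I * k * (2 * Real.pi : ℝ)) = 1 := by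
  rw [Complex.exp_eq_one_iff]
  exact ⟨k, by push_cast; ring⟩

lemma trigPoly_two_pi : trigPoly A c t (2 * Real.pi) = trigPoly A c t 0 := by
  simp only [trigPoly, exp_I_mul_int_mul_two_pi, Complex.ofReal_zero, mul_zero, Complex.exp_zero]

lemma contDiff_trigPoly : ContDiff ℝ 1 (trigPoly A c t) := by
  have h_ofReal : ContDiff ℝ 1 ((↑) : ℝ → ℂ) := Complex.ofRealCLM.contDiff
  exact contDiff_const.mul (.sum fun k _ => (contDiff_const.mul h_ofReal).cexp.mul contDiff_const)

lemma conj_trigPoly (hA : ∀ k, -k ∈ A ↔ k ∈ A) (x : ℝ) :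
    conj (trigPoly A c t x) = trigPoly A (fun k t => conj (c (-k) t)) t x := by
  simp only [trigPoly, map_mul, map_sum, map_div₀, map_one, Complex.conj_ofReal, map_ofNat,
    ← Complex.exp_conj, Complex.conj_I, map_intCast]
  refine congrArg _ (Finset.sum_equiv (Equiv.neg ℤ) (fun k => (hA k).symm) fun k _ => ?_)
  simp

lemma spaceCoeff_one (k : ℤ) :
    spaceCoeff (fun _ _ => 1) k t = if k = 0 then (2 * Real.pi : ℂ) else 0 := by
  simp only [spaceCoeff, mul_one]
  split_ifs with hk
  · simp [hk]
  · have h_ne : -(Complex.I * (k : ℂ)) ≠ 0 := by simp [hk]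
    simp only [← neg_mul (Complex.I * (k : ℂ))]
    rw [integral_exp_mul_complex h_ne, neg_mul, Complex.exp_neg, exp_I_mul_int_mul_two_pi]
    simp

lemma spaceCoeff_mul_trigPoly (hg : Continuous (g t)) (k : ℤ) :
    spaceCoeff (fun t x => g t x * trigPoly B d t x) k t =
      (1 / (2 * Real.pi) : ℂ) * ∑ l ∈ B, spaceCoeff g (k - l) t * d l t := by
  simp only [spaceCoeff, ← intervalIntegral.integral_mul_const]
  rw [← intervalIntegral.integral_finsetSum fun l _ =>
    Continuous.intervalIntegrable (by fun_prop) _ _, ← intervalIntegral.integral_const_mul]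
  refine intervalIntegral.integral_congr fun x _ => ?_
  have h_exp : ∀ l : ℤ, Complex.exp (-(Complex.I * (k - l : ℤ) * x)) =
      Complex.exp (-(Complex.I * k * x)) * Complex.exp (Complex.I * l * x) := fun l => by
    rw [← Complex.exp_add]
    push_cast
    ring_nf
  simp only [trigPoly, h_exp, Finset.mul_sum]
  exact Finset.sum_congr rfl fun l _ => by ring

lemma spaceCoeff_trigPoly (k : ℤ) :
    spaceCoeff (trigPoly A c) k t = if k ∈ A then c k t else 0 := by
  have h_pi : (Real.pi : ℂ) ≠ 0 := mod_cast Real.pi_ne_zero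
  calc spaceCoeff (trigPoly A c) k t
      = (1 / (2 * Real.pi) : ℂ) * ∑ l ∈ A, spaceCoeff (fun _ _ => 1) (k - l) t * c l t := by
        simpa only [one_mul] using
          spaceCoeff_mul_trigPoly (g := fun _ _ => (1 : ℂ)) continuous_const k
    _ = (1 / (2 * Real.pi) : ℂ) * ∑ l ∈ A, if k = l then 2 * Real.pi * c l t else 0 := by
        simp only [spaceCoeff_one, sub_eq_zero, ite_mul, zero_mul]
    _ = if k ∈ A then c k t else 0 := by
        rw [Finset.sum_ite_eq]
        split_ifs
        · field_simp
        · exact mul_zero _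

lemma spaceCoeff_trigPoly_mul_trigPoly (k : ℤ) :
    spaceCoeff (fun t x => trigPoly A c t x * trigPoly B d t x) k t =
      (1 / (2 * Real.pi) : ℂ) * ∑ l ∈ B with k - l ∈ A, c (k - l) t * d l t := by
  rw [spaceCoeff_mul_trigPoly contDiff_trigPoly.continuous]
  simp only [spaceCoeff_trigPoly, ite_mul, zero_mul, Finset.sum_filter]

lemma spaceCoeff_dx (hg : ContDiff ℝ 1 (g t)) (h_period : g t (2 * Real.pi) = g t 0) (k : ℤ) :
    spaceCoeff (dx g) k t = Complex.I * k * spaceCoeff g k t := by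
  have h_exp : ∀ x : ℝ, HasDerivAt (fun x : ℝ => Complex.exp (-(Complex.I * k * x)))
      (-(Complex.I * k) * Complex.exp (-(Complex.I * k * x))) x := fun x => by
    have h_lin : HasDerivAt (fun x : ℝ => -(Complex.I * k * (x : ℂ))) (-(Complex.I * k)) x := by
      simpa using ((Complex.ofRealCLM.hasDerivAt (x := x)).const_mul (Complex.I * (k : ℂ))).fun_neg
    simpa only [mul_comm] using h_lin.cexp
  simp only [spaceCoeff, dx]
  rw [intervalIntegral.integral_mul_deriv_eq_deriv_mul (fun x _ => h_exp x)
    (fun x _ => (hg.differentiable one_ne_zero x).hasDerivAt)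
    (Continuous.intervalIntegrable (by fun_prop) _ _)
    ((hg.continuous_deriv le_rfl).intervalIntegrable _ _), h_period,
    Complex.exp_neg, exp_I_mul_int_mul_two_pi, inv_one]
  simp only [Complex.ofReal_zero, mul_zero, neg_zero, Complex.exp_zero, sub_self, zero_sub,
    mul_assoc, neg_mul, intervalIntegral.integral_neg, intervalIntegral.integral_const_mul, neg_neg]

end TrigonometricPolynomial

section LittlewoodPaley

open scoped ComplexConjugate

variable {u v : STDist} {t : ℝ}

/-- The spatial Fourier coefficient `û_k(t)` of `u`, when `ũ(k, ·)` is an integrable function. -/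
noncomputable def timeCoeff (u : STDist) (k : ℤ) (t : ℝ) : ℂ :=
  (1 / (2 * Real.pi) : ℂ) * invFourier (stFourier u k) t

lemma proj_eq_trigPoly (N : ℕ) (u : STDist) : proj N u = trigPoly (shell N) (timeCoeff u) := rfl

lemma mem_shell {N : ℕ} {k : ℤ} : k ∈ shell N ↔ (N : ℤ) ≤ |k| ∧ |k| < 2 * N := by
  simp only [shell, Finset.mem_filter, Finset.mem_Ioo, abs_lt]
  tauto

lemma ne_zero_of_mem_shell {N : ℕ} {k : ℤ} (hk : k ∈ shell N) : k ≠ 0 := by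
  rintro rfl
  have h := mem_shell.mp hk
  simp only [abs_zero] at h
  lia

lemma spaceCoeff_proj_mul_proj (N₁ N₂ : ℕ) (k : ℤ) :
    spaceCoeff (fun t x => proj N₁ u t x * proj N₂ v t x) k t = (1 / (2 * Real.pi) : ℂ) *
      ∑ l ∈ shell N₂ with k - l ∈ shell N₁, timeCoeff u (k - l) t * timeCoeff v l t :=
  spaceCoeff_trigPoly_mul_trigPoly k

lemma spaceCoeff_dx_proj_mul_conj_proj (N₁ N₂ : ℕ) (k : ℤ) :
    spaceCoeff (dx fun t x => proj N₁ u t x * conj (proj N₂ v t x)) k t =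
      (1 / (2 * Real.pi) : ℂ) * (Complex.I * k * ∑ l ∈ shell N₂ with k - l ∈ shell N₁,
        timeCoeff u (k - l) t * conj (timeCoeff v (-l) t)) := by
  have h_conj : ∀ t x, conj (proj N₂ v t x) =
      trigPoly (shell N₂) (fun l t => conj (timeCoeff v (-l) t)) t x := fun t x => by
    rw [proj_eq_trigPoly, conj_trigPoly fun k => by simp only [mem_shell, abs_neg]]
  simp only [h_conj]
  rw [proj_eq_trigPoly,
    spaceCoeff_dx (contDiff_trigPoly.mul contDiff_trigPoly) (by simp only [trigPoly_two_pi]),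
    spaceCoeff_trigPoly_mul_trigPoly, mul_left_comm]

lemma spaceCoeff_projFun (N : ℕ) (g : ℝ → ℝ → ℂ) (k : ℤ) :
    spaceCoeff (projFun N g) k t = if k ∈ shell N then spaceCoeff g k t else 0 :=
  spaceCoeff_trigPoly k

end LittlewoodPaley

section Norms

/-- The absolute value of the Fourier transform of `⟨D⟩^s u` when `f` is that of `u`. -/
noncomputable def freqWeighted (s : ℝ) (f : ℤ → ℝ → ℂ) (x : ℤ × ℝ) : ℝ≥0∞ :=
  ⟪x.1⟫ ^ s * ‖f x.1 x.2‖ₑ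

variable {m : ℤ → ℝ → ℝ} {s : ℝ} {u : STDist} {f g : ℤ → ℝ → ℂ}

lemma measurable_freqWeighted (hf : ∀ k, Measurable (f k)) : Measurable (freqWeighted s f) :=
  measurable_from_prod_countable_right fun k => (hf k).enorm.const_mul (⟪k⟫ ^ s)

lemma l2L2_congr_ae (w : ℤ → ℝ → ℝ) (h : ∀ k, f k =ᵐ[volume] g k) : l2L2 w f = l2L2 w g := by
  refine congrArg (· ^ (1 / 2 : ℝ)) (tsum_congr fun k => lintegral_congr_ae ?_)
  filter_upwards [h k] with τ hτ using by rw [hτ]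

lemma l2L1_congr_ae (w : ℤ → ℝ → ℝ) (h : ∀ k, f k =ᵐ[volume] g k) : l2L1 w f = l2L1 w g := by
  refine congrArg (· ^ (1 / 2 : ℝ)) (tsum_congr fun k => congrArg (· ^ 2) (lintegral_congr_ae ?_))
  filter_upwards [h k] with τ hτ using by rw [hτ]

lemma ofReal_weight_mul_enorm (m : ℤ → ℝ → ℝ) (s b : ℝ) (f : ℤ → ℝ → ℂ) (k : ℤ) (τ : ℝ) :
    ENNReal.ofReal (bracket k ^ s * bracket (m k τ) ^ b) * ‖f k τ‖ₑ =
      modWeight m (k, τ) ^ b * freqWeighted s f (k, τ) := by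
  rw [ENNReal.ofReal_mul (Real.rpow_nonneg (bracket_pos _).le _), ← ebracket_rpow,
    ← ebracket_rpow, modWeight, freqWeighted]
  ring

lemma sq_l2L2_weight (m : ℤ → ℝ → ℝ) (s b : ℝ) (f : ℤ → ℝ → ℂ) :
    l2L2 (fun k τ => bracket k ^ s * bracket (m k τ) ^ b) f ^ 2 =
      ∑' k : ℤ, ∫⁻ τ, (modWeight m (k, τ) ^ b * freqWeighted s f (k, τ)) ^ 2 := by
  simp only [l2L2, ofReal_weight_mul_enorm, ← ENNReal.rpow_mul_natCast]
  norm_num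

lemma sq_l2L1_weight (m : ℤ → ℝ → ℝ) (s b : ℝ) (f : ℤ → ℝ → ℂ) :
    l2L1 (fun k τ => bracket k ^ s * bracket (m k τ) ^ b) f ^ 2 =
      ∑' k : ℤ, (∫⁻ τ, modWeight m (k, τ) ^ b * freqWeighted s f (k, τ)) ^ 2 := by
  simp only [l2L1, ofReal_weight_mul_enorm, ← ENNReal.rpow_mul_natCast]
  norm_num

lemma normY_of_hasSTFourier (h : HasSTFourier u) : normY m s u =
    l2L2 (fun k τ => bracket k ^ s * bracket (m k τ) ^ (1 / 2 : ℝ)) (stFourier u) +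
      l2L1 (fun k τ => bracket k ^ s * bracket (m k τ) ^ (0 : ℝ)) (stFourier u) := by
  simp only [normY, normX, if_pos h, Real.rpow_zero, mul_one]

lemma normZ_of_hasSTFourier (h : HasSTFourier u) : normZ m s u =
    l2L2 (fun k τ => bracket k ^ s * bracket (m k τ) ^ (-(1 / 2) : ℝ)) (stFourier u) +
      l2L1 (fun k τ => bracket k ^ s * bracket (m k τ) ^ (-1 : ℝ)) (stFourier u) := by
  simp only [normZ, normX, if_pos h, Real.rpow_neg_one, div_eq_mul_inv, neg_mul]

lemma hasSTFourier_of_normY_lt_top (h : normY m s u < ⊤) : HasSTFourier u := by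
  by_contra h_not
  simp [normY, normX, h_not] at h

lemma HasSTFourier.exists_measurable_ae_eq (h : HasSTFourier u) :
    ∃ f : ℤ → ℝ → ℂ, (∀ k, Measurable (f k)) ∧ ∀ k, stFourier u k =ᵐ[volume] f k := by
  have h_meas : ∀ k, AEStronglyMeasurable (stFourier u k) :=
    fun k => ((isSTFourier_stFourier h).locallyIntegrable k).aestronglyMeasurable
  exact ⟨fun k => (h_meas k).mk, fun k => (h_meas k).stronglyMeasurable_mk.measurable,
    fun k => (h_meas k).ae_eq_mk⟩

lemma yEnergy_freqWeighted_le (hm : Measurable m.uncurry) (hu : HasSTFourier u)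
    (hf : ∀ k, Measurable (f k)) (huf : ∀ k, stFourier u k =ᵐ[volume] f k) :
    yEnergy m (freqWeighted s f) ≤ normY m s u ^ 2 := by
  rw [normY_of_hasSTFourier hu, l2L2_congr_ae _ huf, l2L1_congr_ae _ huf]
  refine le_trans (le_of_eq ?_) (pow_add_pow_le zero_le zero_le two_ne_zero)
  have := measurable_freqWeighted (s := s) hf
  have : Measurable (modWeight m) := measurable_ebracket.comp hm
  rw [sq_l2L2_weight, sq_l2L1_weight, yEnergy, modEnergy, lintegral_stVol (by fun_prop)]
  simp only [mul_pow, ← ENNReal.rpow_mul_natCast, ENNReal.rpow_zero, one_mul]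
  norm_num

lemma integrable_of_yEnergy_ne_top (hf : ∀ k, Measurable (f k))
    (h : yEnergy m (freqWeighted s f) ≠ ⊤) (k : ℤ) : Integrable (f k) := by
  have h_sq : (⟪k⟫ ^ s * ∫⁻ τ, ‖f k τ‖ₑ) ^ 2 ≠ ⊤ := by
    rw [← lintegral_const_mul _ (hf k).enorm]
    exact ne_top_of_le_ne_top h ((ENNReal.le_tsum k).trans le_add_self)
  refine ⟨(hf k).aestronglyMeasurable, lt_top_iff_ne_top.mpr fun h_top => h_sq ?_⟩
  rw [h_top, ENNReal.mul_top (ebracket_rpow_ne_zero _ _)]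
  rfl

lemma normZ_le (hu : IsSTFourier u f) (hm : Measurable m.uncurry) {H : ℤ × ℝ → ℝ≥0∞}
    (hH : Measurable H) (hfH : ∀ x, freqWeighted s f x ≤ H x) {D : ℝ≥0∞}
    (h_L2 : ∫⁻ x, (modWeight m x ^ (-(1 / 2) : ℝ) * H x) ^ 2 ∂stVol ≤ D ^ 2)
    (h_L1 : ∑' k : ℤ, (∫⁻ τ, (modWeight m (k, τ))⁻¹ * H (k, τ)) ^ 2 ≤ D ^ 2) :
    normZ m s u ≤ 2 * D := by
  have h_ae := (isSTFourier_stFourier ⟨f, hu⟩).ae_eq hu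
  have : Measurable (modWeight m) := measurable_ebracket.comp hm
  rw [lintegral_stVol (by fun_prop)] at h_L2
  simp only [← ENNReal.rpow_neg_one] at h_L1
  rw [normZ_of_hasSTFourier ⟨f, hu⟩, l2L2_congr_ae _ h_ae, l2L1_congr_ae _ h_ae, two_mul]
  refine add_le_add ((ENNReal.pow_le_pow_left_iff two_ne_zero).mp ?_)
    ((ENNReal.pow_le_pow_left_iff two_ne_zero).mp ?_)
  · rw [sq_l2L2_weight]
    exact le_trans (ENNReal.tsum_le_tsum fun k => lintegral_mono fun τ =>
      pow_le_pow_left' (mul_le_mul_right (hfH _) _) 2) h_L2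
  · rw [sq_l2L1_weight]
    exact le_trans (ENNReal.tsum_le_tsum fun k => pow_le_pow_left' (lintegral_mono fun τ =>
      mul_le_mul_right (hfH _) _) 2) h_L1

end Norms

section LocalizedMajorant

open scoped ComplexConjugate Convolution

/-- `U` dominates `⟨k⟩^s |a(k, τ)|`, where `a` is the Fourier transform of an element of a `Y` space
of norm `X` localized in time: the energy of `U` with the smaller power `3 / 4` of the modulation
gains a small factor `δ`. -/
structure IsLocalizedMajorant (m : ℤ → ℝ → ℝ) (s : ℝ) (δ X : ℝ≥0∞) (a : ℤ → ℝ → ℂ)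
    (U : ℤ × ℝ → ℝ≥0∞) : Prop where
  integrable : ∀ k, Integrable (a k)
  measurable : Measurable U
  freqWeighted_le : ∀ x, freqWeighted s a x ≤ U x
  modEnergy_one_le : modEnergy m 1 U ≤ X ^ 2
  modEnergy_three_quarters_le : modEnergy m (3 / 4) U ≤ δ * X ^ 2

variable {m : ℤ → ℝ → ℝ} {s : ℝ}

lemma modEnergy_reflect (m : ℤ → ℝ → ℝ) (b : ℝ) (U : ℤ × ℝ → ℝ≥0∞) :
    modEnergy (reflect m) b (fun x => U (-x)) = modEnergy m b U := by
  simp only [modEnergy, modWeight_reflect]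
  exact lintegral_neg_eq_self (μ := stVol) fun x => modWeight m x ^ b * U x ^ 2

lemma IsLocalizedMajorant.reflect {δ X : ℝ≥0∞} {a : ℤ → ℝ → ℂ} {U : ℤ × ℝ → ℝ≥0∞}
    (h : IsLocalizedMajorant m s δ X a U) :
    IsLocalizedMajorant (reflect m) s δ X (fun k τ => conj (a (-k) (-τ))) fun x => U (-x) where
  integrable k := Complex.conjLIE.integrable_comp_iff.mpr (h.integrable (-k)).comp_neg
  measurable := h.measurable.comp measurable_neg
  freqWeighted_le x := by
    refine le_of_eq_of_le ?_ (h.freqWeighted_le (-x))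
    simp only [freqWeighted, RCLike.enorm_conj, Prod.fst_neg, Prod.snd_neg, Int.cast_neg,
      ebracket_neg]
  modEnergy_one_le := (modEnergy_reflect m 1 U).trans_le h.modEnergy_one_le
  modEnergy_three_quarters_le :=
    (modEnergy_reflect m (3 / 4) U).trans_le h.modEnergy_three_quarters_le

lemma enorm_convolution_le (f g : ℝ → ℂ) (x : ℝ) :
    ‖(f ⋆[ContinuousLinearMap.mul ℂ ℂ] g) x‖ₑ ≤ ∫⁻ t, ‖f t‖ₑ * ‖g (x - t)‖ₑ := by
  refine (enorm_integral_le_lintegral_enorm _).trans_eq (lintegral_congr fun t => ?_)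
  rw [ContinuousLinearMap.mul_apply', enorm_mul]

lemma enorm_one_div_two_pi_le : ‖(1 / (2 * Real.pi) : ℂ)‖ₑ ≤ 1 := by
  rw [← ofReal_norm, ENNReal.ofReal_le_one, norm_div, norm_one, norm_mul, Complex.norm_real,
    Real.norm_of_nonneg Real.pi_pos.le, Complex.norm_ofNat, div_le_one (by positivity)]
  linarith [Real.pi_gt_three]

lemma freqWeighted_cutoff_le (η : ℝ → ℂ) (f : ℤ → ℝ → ℂ) (x : ℤ × ℝ) :
    freqWeighted s (fun k τ =>
        (1 / (2 * Real.pi) : ℂ) * (η ⋆[ContinuousLinearMap.mul ℂ ℂ] f k) τ) x ≤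
      timeSmear (fun τ => ‖η τ‖ₑ) (freqWeighted s f) x := by
  calc ⟪x.1⟫ ^ s * ‖(1 / (2 * Real.pi) : ℂ) * (η ⋆[ContinuousLinearMap.mul ℂ ℂ] f x.1) x.2‖ₑ
      ≤ ⟪x.1⟫ ^ s * (1 * ∫⁻ σ, ‖η σ‖ₑ * ‖f x.1 (x.2 - σ)‖ₑ) := by
        rw [enorm_mul]
        gcongr
        exacts [enorm_one_div_two_pi_le, enorm_convolution_le _ _ _]
    _ = ∫⁻ σ, ‖η σ‖ₑ * (⟪x.1⟫ ^ s * ‖f x.1 (-σ + x.2)‖ₑ) := by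
        rw [one_mul, ← lintegral_const_mul' _ _ (ebracket_rpow_ne_top _ _)]
        simp only [neg_add_eq_sub, mul_left_comm]

lemma invFourier_cutoff {η : ℝ → ℂ} (hη : Integrable η) {u : STDist} {f : ℤ → ℝ → ℂ} {k : ℤ}
    (hf : Integrable (f k)) (huf : stFourier u k =ᵐ[volume] f k) {t : ℝ}
    (ht : invFourier η t = 1) :
    invFourier (fun τ => (1 / (2 * Real.pi) : ℂ) * (η ⋆[ContinuousLinearMap.mul ℂ ℂ] f k) τ) t =
      timeCoeff u k t := by
  have h_ae : invFourier (stFourier u k) t = invFourier (f k) t := by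
    refine integral_congr_ae ?_
    filter_upwards [huf] with τ hτ using by rw [hτ]
  rw [timeCoeff, h_ae, invFourier_const_mul, invFourier_convolution hη hf, ht, one_mul]

theorem exists_isLocalizedMajorant : ∃ C : ℝ≥0∞, C ≠ ⊤ ∧ ∀ (T : ℝ) (m : ℤ → ℝ → ℝ) (s : ℝ)
    (u : STDist), 0 < T → (∀ k, LipschitzWith 1 (m k)) → normY m s u < ⊤ →
    ∃ a U, IsLocalizedMajorant m s (ENNReal.ofReal T ^ (1 / 4 : ℝ)) (C * normY m s u) a U ∧
      ∀ k, ∀ t ∈ Set.Ioo 0 T, invFourier (a k) t = timeCoeff u k t := by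
  obtain ⟨A, hA, h_cutoff⟩ := exists_timeCutoff
  refine ⟨(2 * A ^ 2 + 3 * A) ^ (1 / 2 : ℝ), by finiteness, fun T m s u hT hm hu => ?_⟩
  obtain ⟨η, hη_int, hη_one, hη⟩ := h_cutoff T hT
  have h_ft := hasSTFourier_of_normY_lt_top hu
  obtain ⟨f, hf, huf⟩ := h_ft.exists_measurable_ae_eq
  have hm_meas : Measurable m.uncurry :=
    measurable_from_prod_countable_right fun k => (hm k).continuous.measurable
  have hF : Measurable (freqWeighted s f) := measurable_freqWeighted hf
  have h_energy : yEnergy m (freqWeighted s f) ≤ normY m s u ^ 2 :=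
    yEnergy_freqWeighted_le hm_meas h_ft hf huf
  have hf_int : ∀ k, Integrable (f k) :=
    integrable_of_yEnergy_ne_top hf (ne_top_of_le_ne_top (ENNReal.pow_ne_top hu.ne) h_energy)
  have h_sq : ((2 * A ^ 2 + 3 * A) ^ (1 / 2 : ℝ) * normY m s u) ^ 2 =
      (2 * A ^ 2 + 3 * A) * normY m s u ^ 2 := by
    rw [mul_pow, ← ENNReal.rpow_mul_natCast]
    norm_num
  refine ⟨fun k τ => (1 / (2 * Real.pi) : ℂ) * (η ⋆[ContinuousLinearMap.mul ℂ ℂ] f k) τ,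
    timeSmear (fun τ => ‖η τ‖ₑ) (freqWeighted s f), ⟨fun k => ?_, ?_, fun x => ?_, ?_, ?_⟩,
    fun k t ht => ?_⟩
  · exact (hη_int.integrable_convolution _ (hf_int k)).const_mul _
  · exact measurable_timeSmear hη.measurable hF
  · exact freqWeighted_cutoff_le η f x
  · rw [h_sq]
    exact (hη.modEnergy_one_timeSmear_le hm hF).trans (mul_le_mul_right h_energy _)
  · rw [h_sq]
    exact (hη.modEnergy_three_quarters_timeSmear_le (by simpa) ENNReal.ofReal_ne_top hm hF).trans
      (by gcongr)
  · exact invFourier_cutoff hη_int (hf_int k) (huf k) (hη_one t ht)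

end LocalizedMajorant

section ProductExtension

open scoped Convolution

/-- The Fourier transform, up to a power of `2π`, of the product of the functions with transforms
`a` and `b`, restricted to the spatial frequencies in `A` and `B`, after the spatial Fourier
multiplier `μ`. -/
noncomputable def multiplierConv (μ : ℤ → ℂ) (A B : Finset ℤ) (a b : ℤ → ℝ → ℂ) (k : ℤ) (τ : ℝ) :
    ℂ :=
  μ k * ∑ l ∈ B with k - l ∈ A, (b l ⋆[ContinuousLinearMap.mul ℂ ℂ] a (k - l)) τ

variable {μ : ℤ → ℂ} {A B : Finset ℤ} {a b : ℤ → ℝ → ℂ}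

lemma integrable_multiplierConv (ha : ∀ k, Integrable (a k)) (hb : ∀ k, Integrable (b k)) (k : ℤ) :
    Integrable (multiplierConv μ A B a b k) :=
  (integrable_finsetSum _ fun l _ => (hb l).integrable_convolution _ (ha (k - l))).const_mul _

lemma invFourier_finsetSum {ι : Type*} (s : Finset ι) {f : ι → ℝ → ℂ}
    (hf : ∀ i ∈ s, Integrable (f i)) (t : ℝ) :
    invFourier (fun τ => ∑ i ∈ s, f i τ) t = ∑ i ∈ s, invFourier (f i) t := by
  simp only [invFourier, Finset.mul_sum]
  refine integral_finsetSum s fun i hi => (hf i hi).bdd_mul (c := 1) (by fun_prop) ?_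
  refine .of_forall fun τ => le_of_eq ?_
  rw [mul_assoc, mul_comm, ← Complex.ofReal_mul, Complex.norm_exp_ofReal_mul_I]

lemma invFourier_multiplierConv (ha : ∀ k, Integrable (a k)) (hb : ∀ k, Integrable (b k)) (k : ℤ)
    (t : ℝ) : invFourier (multiplierConv μ A B a b k) t =
      μ k * ∑ l ∈ B with k - l ∈ A, invFourier (a (k - l)) t * invFourier (b l) t := by
  change invFourier (fun τ => μ k * _) t = _
  rw [invFourier_const_mul,
    invFourier_finsetSum _ fun l _ => (hb l).integrable_convolution _ (ha (k - l))]
  simp only [invFourier_convolution (hb _) (ha _), mul_comm (invFourier (b _) t)]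

variable {M : ℤ → ℤ → ℝ≥0∞} {U V : ℤ × ℝ → ℝ≥0∞} {s₀ s₁ s₂ : ℝ}

lemma freqWeighted_multiplierConv_le (hU : Measurable U) (hV : Measurable V)
    (haU : ∀ x, freqWeighted s₁ a x ≤ U x) (hbV : ∀ x, freqWeighted s₂ b x ≤ V x)
    (hμ : ∀ k, ∀ l ∈ B, k - l ∈ A →
      ⟪k⟫ ^ s₀ * ‖μ k‖ₑ ≤ M (k - l) l * (⟪(k - l : ℤ)⟫ ^ s₁ * ⟪l⟫ ^ s₂))
    (x : ℤ × ℝ) :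
    freqWeighted s₀ (multiplierConv μ A B a b) x ≤ bilinConv (fun y z => M y.1 z.1) U V x := by
  obtain ⟨k, τ⟩ := x
  have hM : Measurable fun y : ℤ × ℤ => M y.1 y.2 := .of_discrete
  have h_term : ∀ l ∈ B, k - l ∈ A →
      ⟪k⟫ ^ s₀ * ‖μ k‖ₑ * ‖(b l ⋆[ContinuousLinearMap.mul ℂ ℂ] a (k - l)) τ‖ₑ ≤
        ∫⁻ σ, M (k - l) l * (U (k - l, τ - σ) * V (l, σ)) := fun l hl hkl => by
    calc ⟪k⟫ ^ s₀ * ‖μ k‖ₑ * ‖(b l ⋆[ContinuousLinearMap.mul ℂ ℂ] a (k - l)) τ‖ₑ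
        ≤ M (k - l) l * (⟪(k - l : ℤ)⟫ ^ s₁ * ⟪l⟫ ^ s₂) *
          ∫⁻ σ, ‖b l σ‖ₑ * ‖a (k - l) (τ - σ)‖ₑ :=
          mul_le_mul' (hμ k l hl hkl) (enorm_convolution_le _ _ _)
      _ ≤ ∫⁻ σ, M (k - l) l * (freqWeighted s₁ a (k - l, τ - σ) * freqWeighted s₂ b (l, σ)) := by
          refine (lintegral_const_mul_le _ _).trans_eq (lintegral_congr fun σ => ?_)
          simp only [freqWeighted]
          ring
      _ ≤ ∫⁻ σ, M (k - l) l * (U (k - l, τ - σ) * V (l, σ)) :=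
          lintegral_mono fun σ => mul_le_mul_right (mul_le_mul' (haU _) (hbV _)) _
  calc freqWeighted s₀ (multiplierConv μ A B a b) (k, τ)
      ≤ ∑ l ∈ B with k - l ∈ A,
          ⟪k⟫ ^ s₀ * ‖μ k‖ₑ * ‖(b l ⋆[ContinuousLinearMap.mul ℂ ℂ] a (k - l)) τ‖ₑ := by
        rw [freqWeighted, multiplierConv, enorm_mul, ← mul_assoc, ← Finset.mul_sum]
        exact mul_le_mul_right (enorm_sum_le _ _) _
    _ ≤ ∑ l ∈ B with k - l ∈ A, ∫⁻ σ, M (k - l) l * (U (k - l, τ - σ) * V (l, σ)) :=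
        Finset.sum_le_sum fun l hl =>
          h_term l (Finset.mem_filter.mp hl).1 (Finset.mem_filter.mp hl).2
    _ ≤ ∑' l, ∫⁻ σ, M (k - l) l * (U (k - l, τ - σ) * V (l, σ)) := ENNReal.sum_le_tsum _
    _ = bilinConv (fun y z => M y.1 z.1) U V (k, τ) := by
        rw [bilinConv, lintegral_stVol (by fun_prop)]
        rfl

lemma agreesOn_of_invFourier_eq {F : STDist} {f : ℤ → ℝ → ℂ} {g : ℝ → ℝ → ℂ} {T : ℝ}
    (hF : ∀ (k : ℤ) (φ : 𝓢(ℝ, ℂ)),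
      F k φ = ∫ t, (1 / (2 * Real.pi) : ℂ) * invFourier (f k) t * φ t)
    (hg : ∀ k, ∀ t ∈ Set.Ioo 0 T,
      spaceCoeff g k t = (1 / (2 * Real.pi) : ℂ) * invFourier (f k) t) : AgreesOn T F g := by
  intro k φ hφ
  rw [hF]
  refine integral_congr_ae (.of_forall fun t => ?_)
  by_cases ht : t ∈ tsupport φ
  · simp only [hg k t (hφ ht)]
  · simp only [image_eq_zero_of_notMem_tsupport ht, mul_zero]

theorem BilinearEstimate.exists_extension {m₀ m₁ m₂ : ℤ → ℝ → ℝ} (h : BilinearEstimate M m₀ m₁ m₂)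
    (hm₀ : Measurable m₀.uncurry) (s₀ s₁ s₂ : ℝ) :
    ∃ K : ℝ≥0∞, K ≠ ⊤ ∧ ∀ {δ X Y : ℝ≥0∞} {a b : ℤ → ℝ → ℂ} {U V : ℤ × ℝ → ℝ≥0∞} {μ : ℤ → ℂ}
      {A B : Finset ℤ} {T : ℝ} {g : ℝ → ℝ → ℂ},
      IsLocalizedMajorant m₁ s₁ δ X a U → IsLocalizedMajorant m₂ s₂ δ Y b V →
      (∀ k, ∀ l ∈ B, k - l ∈ A →
        ⟪k⟫ ^ s₀ * ‖μ k‖ₑ ≤ M (k - l) l * (⟪(k - l : ℤ)⟫ ^ s₁ * ⟪l⟫ ^ s₂)) →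
      (∀ k, ∀ t ∈ Set.Ioo 0 T, spaceCoeff g k t = (1 / (2 * Real.pi) : ℂ) *
        (μ k * ∑ l ∈ B with k - l ∈ A, invFourier (a (k - l)) t * invFourier (b l) t)) →
      ∃ F, AgreesOn T F g ∧ normZ m₀ s₀ F ≤ K * δ ^ (1 / 2 : ℝ) * X * Y := by
  obtain ⟨C, hC, h_est⟩ := h
  refine ⟨2 * (2 * C) ^ (1 / 2 : ℝ), by finiteness,
    fun {δ X Y a b U V μ A B T g} hU hV hμ hg => ?_⟩
  obtain ⟨F, hF, hF_apply⟩ := exists_isSTFourier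
    (integrable_multiplierConv (μ := μ) (A := A) (B := B) hU.integrable hV.integrable)
  refine ⟨F, agreesOn_of_invFourier_eq hF_apply fun k t ht => ?_, ?_⟩
  · rw [hg k t ht, invFourier_multiplierConv hU.integrable hV.integrable]
  set D : ℝ≥0∞ := (2 * C) ^ (1 / 2 : ℝ) * δ ^ (1 / 2 : ℝ) * X * Y with hD
  have hM : Measurable fun y : ℤ × ℤ => M y.1 y.2 := .of_discrete
  have h_energy : C * (modEnergy m₁ 1 U * modEnergy m₂ (3 / 4) V +
      modEnergy m₁ (3 / 4) U * modEnergy m₂ 1 V) ≤ D ^ 2 :=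
    calc _ ≤ C * (X ^ 2 * (δ * Y ^ 2) + δ * X ^ 2 * Y ^ 2) := by
          gcongr
          exacts [hU.modEnergy_one_le, hV.modEnergy_three_quarters_le,
            hU.modEnergy_three_quarters_le, hV.modEnergy_one_le]
      _ = D ^ 2 := by
          simp only [hD, mul_pow, ← ENNReal.rpow_mul_natCast]
          norm_num
          ring
  obtain ⟨h_L2, h_L1⟩ := h_est U V hU.measurable hV.measurable
  refine (normZ_le hF hm₀ (measurable_bilinConv (by fun_prop) hU.measurable hV.measurable)
    (freqWeighted_multiplierConv_le hU.measurable hV.measurable hU.freqWeighted_le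
      hV.freqWeighted_le hμ) (h_L2.trans h_energy) (h_L1.trans h_energy)).trans_eq ?_
  rw [hD]
  ring

end ProductExtension

section Nonlinearity

lemma lipschitzWith_modS (α : ℝ) (k : ℤ) : LipschitzWith 1 (modS α k) :=
  .of_dist_le_mul fun τ σ => by simp [modS]

lemma lipschitzWith_modW (β : ℝ) (k : ℤ) : LipschitzWith 1 (modW β k) :=
  .of_dist_le_mul fun τ σ => by
    simpa [modW, Real.dist_eq] using abs_abs_sub_abs_le τ σ

lemma ebracket_rpow_mul_enorm_derivative_le (k : ℤ) :
    ⟪k⟫ ^ (-1 / 2 : ℝ) * ‖Complex.I * (k : ℂ)‖ₑ ≤ ⟪k⟫ ^ (1 / 2 : ℝ) := by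
  have h_enorm : ‖Complex.I * (k : ℂ)‖ₑ ≤ ⟪k⟫ := by
    rw [← ofReal_norm, norm_mul, Complex.norm_I, one_mul, Complex.norm_intCast]
    exact ENNReal.ofReal_le_ofReal (abs_le_bracket _)
  calc ⟪k⟫ ^ (-1 / 2 : ℝ) * ‖Complex.I * (k : ℂ)‖ₑ
      ≤ ⟪k⟫ ^ (-1 / 2 : ℝ) * ⟪k⟫ ^ (1 : ℝ) := by
        rw [ENNReal.rpow_one]
        exact mul_le_mul_right h_enorm _
    _ = ⟪k⟫ ^ (1 / 2 : ℝ) := by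
        rw [← ebracket_rpow_add]
        norm_num

variable {α β : ℝ}

theorem normZSOn_proj_mul_proj_le (hα : α ≠ 0) (hαβ : ∀ m : ℤ, β / α ≠ m) :
    ∃ K : ℝ≥0∞, K ≠ ⊤ ∧ ∀ (T : ℝ) (N₀ N₁ N₂ : ℕ) (u v : STDist), 0 < T →
      normYS α 0 u < ⊤ → normYW β (-1 / 2) v < ⊤ →
      normZSOn α 0 T (projFun N₀ (fun t x => proj N₁ u t x * proj N₂ v t x)) ≤
        K * ENNReal.ofReal T ^ (1 / 8 : ℝ) * normYS α 0 u * normYW β (-1 / 2) v := by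
  obtain ⟨K, hK, h_ext⟩ := (bilinearEstimate_schroedinger hα hαβ).exists_extension
    (isTwoBranched_modS α).measurable 0 0 (-1 / 2)
  obtain ⟨C, hC, h_maj⟩ := exists_isLocalizedMajorant
  refine ⟨K * C * C, by finiteness, fun T N₀ N₁ N₂ u v hT hu hv => ?_⟩
  obtain ⟨a, U, hU, ha⟩ := h_maj T _ 0 u hT (lipschitzWith_modS α) hu
  obtain ⟨b, V, hV, hb⟩ := h_maj T _ (-1 / 2) v hT (lipschitzWith_modW β) hv
  obtain ⟨F, hF, h_le⟩ := h_ext (μ := fun k => if k ∈ shell N₀ then 1 else 0)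
    (A := shell N₁) (B := shell N₂) (T := T)
    (g := projFun N₀ fun t x => proj N₁ u t x * proj N₂ v t x) hU hV
    (fun k l hl _ => by
      calc _ ≤ (1 : ℝ≥0∞) := by split_ifs <;> simp
        _ = _ := by
          rw [if_neg (ne_zero_of_mem_shell hl), ENNReal.rpow_zero, one_mul, ← ebracket_rpow_add]
          norm_num)
    (fun k t ht => by
      simp only [spaceCoeff_projFun, spaceCoeff_proj_mul_proj, ha _ t ht, hb _ t ht]
      split_ifs <;> simp)
  calc _ ≤ normZS α 0 F := iInf₂_le F hF
    _ ≤ _ := h_le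
    _ = _ := by
      rw [← ENNReal.rpow_mul, normYS, normYW]
      norm_num
      ring

theorem normZWOn_dx_proj_mul_conj_proj_le (hα : α ≠ 0) (hαβ : ∀ m : ℤ, β / α ≠ m) :
    ∃ K : ℝ≥0∞, K ≠ ⊤ ∧ ∀ (T : ℝ) (N₀ N₁ N₂ : ℕ) (u v : STDist), 0 < T →
      normYS α 0 u < ⊤ → normYS α 0 v < ⊤ →
      normZWOn β (-1 / 2) T
          (projFun N₀ (dx (fun t x => proj N₁ u t x * (starRingEnd ℂ) (proj N₂ v t x)))) ≤
        K * ENNReal.ofReal T ^ (1 / 8 : ℝ) * normYS α 0 u * normYS α 0 v := by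
  obtain ⟨K, hK, h_ext⟩ := (bilinearEstimate_wave hα hαβ).exists_extension
    (isTwoBranched_modW β).measurable (-1 / 2) 0 0
  obtain ⟨C, hC, h_maj⟩ := exists_isLocalizedMajorant
  refine ⟨K * C * C, by finiteness, fun T N₀ N₁ N₂ u v hT hu hv => ?_⟩
  obtain ⟨a, U, hU, ha⟩ := h_maj T _ 0 u hT (lipschitzWith_modS α) hu
  obtain ⟨b, V, hV, hb⟩ := h_maj T _ 0 v hT (lipschitzWith_modS α) hv
  obtain ⟨F, hF, h_le⟩ := h_ext (μ := fun k => if k ∈ shell N₀ then Complex.I * k else 0)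
    (A := shell N₁) (B := shell N₂) (T := T)
    (g := projFun N₀ (dx fun t x => proj N₁ u t x * (starRingEnd ℂ) (proj N₂ v t x))) hU hV.reflect
    (fun k l _ _ => by
      simp only [sub_add_cancel, ENNReal.rpow_zero, mul_one]
      split_ifs with hk hk0 hk0
      · simp [hk0]
      · exact ebracket_rpow_mul_enorm_derivative_le k
      · simp
      · simp)
    (fun k t ht => by
      simp only [spaceCoeff_projFun, spaceCoeff_dx_proj_mul_conj_proj, invFourier_conj_neg,
        ha _ t ht, hb _ t ht]
      split_ifs <;> simp)
  calc _ ≤ normZW β (-1 / 2) F := iInf₂_le F hF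
    _ ≤ _ := h_le
    _ = _ := by
      rw [← ENNReal.rpow_mul, normYS, normYS]
      norm_num
      ring

lemma mul_ofReal_rpow_le {K : ℝ≥0∞} {C : ℝ} (hK : K ≤ ENNReal.ofReal C) {T γ δ : ℝ} (hT : 0 < T)
    (hT1 : T ≤ 1) (hγ : γ ≤ δ) : K * ENNReal.ofReal T ^ δ ≤ ENNReal.ofReal (C * T ^ γ) := by
  rw [ENNReal.ofReal_mul' (Real.rpow_nonneg hT.le _), ENNReal.ofReal_rpow_of_pos hT]
  exact mul_le_mul' hK
    (ENNReal.ofReal_le_ofReal (Real.rpow_le_rpow_of_exponent_ge hT hT1 hγ))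

theorem proposition4p1_general (α β : ℝ) (hα : α ≠ 0) (hαβ : ∀ m : ℤ, β / α ≠ (m : ℝ)) :
    ∃ C : ℝ, 0 < C ∧ ∀ γ : ℝ, γ ≤ 1 / 8 → ∀ T : ℝ, 0 < T → T ≤ 1 → ∀ N₀ N₁ N₂ : ℕ,
      (∀ u v : STDist, normYS α 0 u < ⊤ → normYW β (-1 / 2) v < ⊤ →
        normZSOn α 0 T (projFun N₀ (fun t x => proj N₁ u t x * proj N₂ v t x)) ≤
          ENNReal.ofReal (C * T ^ γ) * normYS α 0 u * normYW β (-1 / 2) v) ∧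
      (∀ u v : STDist, normYS α 0 u < ⊤ → normYS α 0 v < ⊤ →
        normZWOn β (-1 / 2) T
            (projFun N₀ (dx (fun t x => proj N₁ u t x * (starRingEnd ℂ) (proj N₂ v t x)))) ≤
          ENNReal.ofReal (C * T ^ γ) * normYS α 0 u * normYS α 0 v) := by
  obtain ⟨K₁, hK₁, h_schroedinger⟩ := normZSOn_proj_mul_proj_le hα hαβ
  obtain ⟨K₂, hK₂, h_wave⟩ := normZWOn_dx_proj_mul_conj_proj_le hα hαβ
  have h_const : ENNReal.ofReal (K₁ + K₂ + 1).toReal = K₁ + K₂ + 1 :=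
    ENNReal.ofReal_toReal (by finiteness)
  refine ⟨(K₁ + K₂ + 1).toReal, ENNReal.toReal_pos (by simp) (by finiteness),
    fun γ hγ T hT hT1 N₀ N₁ N₂ => ⟨fun u v hu hv => ?_, fun u v hu hv => ?_⟩⟩
  · refine (h_schroedinger T N₀ N₁ N₂ u v hT hu hv).trans ?_
    gcongr
    exact mul_ofReal_rpow_le ((le_self_add.trans le_self_add).trans_eq h_const.symm) hT hT1 hγ
  · refine (h_wave T N₀ N₁ N₂ u v hT hu hv).trans ?_
    gcongr
    exact mul_ofReal_rpow_le ((le_add_self.trans le_self_add).trans_eq h_const.symm) hT hT1 hγ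

end Nonlinearity

end Zakharov

open Zakharov in
theorem proposition4p1 (α β : ℝ) (hα : 0 < α) (hβ : 0 < β)
    (hαβ : ∀ m : ℤ, β / α ≠ (m : ℝ)) :
    ∃ γ₀ : ℝ, 0 < γ₀ ∧ ∀ γ : ℝ, 0 < γ → γ < γ₀ →
      ∃ C : ℝ, 0 < C ∧
        ∀ T : ℝ, 0 < T → T < 1 →
        ∀ N₀ N₁ N₂ : ℕ, (∃ j : ℕ, N₀ = 2 ^ j) → (∃ j : ℕ, N₁ = 2 ^ j) → (∃ j : ℕ, N₂ = 2 ^ j) →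
          (∀ u v : STDist, normYS α 0 u < ⊤ → normYW β (-1 / 2) v < ⊤ →
            normZSOn α 0 T (projFun N₀ (fun t x => proj N₁ u t x * proj N₂ v t x)) ≤
              ENNReal.ofReal (C * T ^ γ) * normYS α 0 u * normYW β (-1 / 2) v) ∧
          (∀ u v : STDist, normYS α 0 u < ⊤ → normYS α 0 v < ⊤ →
            normZWOn β (-1 / 2) T
                (projFun N₀ (dx (fun t x => proj N₁ u t x * (starRingEnd ℂ) (proj N₂ v t x)))) ≤
              ENNReal.ofReal (C * T ^ γ) * normYS α 0 u * normYS α 0 v) := by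
  obtain ⟨C, hC, h⟩ := proposition4p1_general α β hα.ne' hαβ
  exact ⟨1 / 8, by norm_num, fun γ _ hγ => ⟨C, hC, fun T hT hT1 N₀ N₁ N₂ _ _ _ =>
    h γ hγ.le T hT hT1.le N₀ N₁ N₂⟩⟩
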